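/- Let $(R,m)$ be a Noetherian local ring of dimension $d$. A \emph{parameter ideal} of $R$ is an ideal $I=(f_1,\dots,f_d)$ generated by a system of parameters of $R$, i.e. by $d=\dim R$ elements with $\sqrt{I}=m$. Write $H^i(f_1,\dots,f_d;M)$ for the $i$-th Koszul cohomology module of $f_1,\dots,f_d$ on an $R$-module $M$, and $\ell$ for length. A finitely generated $R$-module $M$ is called \emph{$i$-effaceable} if for every sequence of parameter ideals $I_n=(x_{1n},\dots,x_{dn})\subseteq m^n$ of $R$ one has $$\lim_{n\to\infty}\frac{\ell\bigl(H^i(x_{1n},\dots,x_{dn};M)\bigr)}{\ell(R/I_n)}=0 .$$ \textbf{Theorem.} Let $d\ge 3$, $k\ge 1$, $s\ge 1$ and $1\le h\le d-1$ be integers, let $\kappa$ be a field and let $V=(V,pV,\kappa_V)$ be a discrete valuation ring with uniformizer $p$. Let $R$ and the ideal $M\subseteq R$ be one of the following: 1. $R=\kappa[[x_1,\dots,x_d]]$ and $M=(x_1,\dots,x_{d-h})$; 2. $R=V[[x_1,\dots,x_{d-1}]]$ and $M=(p^k,x_1,\dots,x_{d-(h+1)})$; 3. $R=V[[x_1,\dots,x_{d-1}]]$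 and $M=(x_1,\dots,x_{d-h})$; 4. $R=V[[x_1,\dots,x_d]]/(p^sx_1)$ and $M=(p^k,x_1,\dots,x_{d-h})$; 5. $R=V[[x_1,\dots,x_d]]/(p^sx_1)$ and $M=(p^k,x_2,\dots,x_{d-(h-1)})$; 6. $R=V[[x_1,\dots,x_d]]/(p^sx_1)$ and $M=(x_1,\dots,x_{d-(h-1)})$. (In case 2 with $h=d-1$ the list of variables is empty and $M=(p^k)$.) Then the $R$-module $N=R/M$ is not $h$-effaceable, and if $h\le d-2$, then $M$, regarded as an $R$-module, is not $(h+1)$-effaceable. -/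

import Mathlib

open Filter Topology
open scoped ENNReal

noncomputable section

/-! ### Koszul cohomology -/

/-- Koszul cochains of degree `i` on `d` elements with values in `M`: a value in `M` for every
`i`-element subset of the index set, i.e. `Hom(⋀^i R^d, M)` in the standard basis. -/
abbrev KoszulCochain (d : ℕ) (M : Type*) (i : ℕ) : Type _ :=
  {S : Finset (Fin d) // S.card = i} → M

/-- The Koszul differential
`(δ φ)(T) = ∑_{j ∈ T} (-1)^{#{l ∈ T | l < j}} x_j φ(T \ {j})`. -/
def koszulDifferential {R : Type*} [CommRing R] {d : ℕ} (x : Fin d → R)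
    (M : Type*) [AddCommGroup M] [Module R M] (i : ℕ) :
    KoszulCochain d M i →ₗ[R] KoszulCochain d M (i + 1) where
  toFun φ := fun T => ∑ j : {j : Fin d // j ∈ T.1},
    ((-1 : R) ^ (T.1.filter (fun l => l < j.1)).card * x j.1) •
      φ ⟨T.1.erase j.1, by rw [Finset.card_erase_of_mem j.2, T.2]; rfl⟩
  map_add' φ ψ := by
    funext T
    simp [Finset.sum_add_distrib]
  map_smul' r φ := by
    funext T
    simp only [Pi.smul_apply, RingHom.id_apply, Finset.smul_sum]
    exact Finset.sum_congr rfl fun j _ => smul_comm _ _ _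

/-- The coboundaries of degree `i` in the Koszul cochain complex. -/
def koszulCoboundaries {R : Type*} [CommRing R] {d : ℕ} (x : Fin d → R)
    (M : Type*) [AddCommGroup M] [Module R M] : (i : ℕ) → Submodule R (KoszulCochain d M i)
  | 0 => ⊥
  | i + 1 => LinearMap.range (koszulDifferential x M i)

/-- The Koszul cohomology module `H^i(x_1, …, x_d; M)`: cocycles modulo coboundaries. -/
abbrev KoszulCohomology {R : Type*} [CommRing R] {d : ℕ} (x : Fin d → R)
    (M : Type*) [AddCommGroup M] [Module R M] (i : ℕ) : Type _ :=
  LinearMap.ker (koszulDifferential x M i) ⧸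
    (koszulCoboundaries x M i).submoduleOf (LinearMap.ker (koszulDifferential x M i))

/-! ### Parameter ideals and effaceability -/

/-- `x_1, …, x_d` is a system of parameters of the local ring `R`: `d = dim R` and the ideal
`(x_1, …, x_d)` is primary to the maximal ideal. -/
def IsSystemOfParameters {R : Type*} [CommRing R] [IsLocalRing R] {d : ℕ} (x : Fin d → R) : Prop :=
  ringKrullDim R = d ∧ (Ideal.span (Set.range x)).radical = IsLocalRing.maximalIdeal R

/-- `M` is `i`-effaceable over the (Noetherian) local ring `R`: for every sequence of parameter
ideals `I_n = (x_{1n}, …, x_{dn}) ⊆ m^n`, the ratio `ℓ(H^i(x_{1n}, …, x_{dn}; M)) / ℓ(R / I_n)`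
tends to `0`. -/
def IsEffaceable (R : Type*) [CommRing R] [IsLocalRing R] [IsNoetherianRing R]
    (M : Type*) [AddCommGroup M] [Module R M] (i : ℕ) : Prop :=
  ∀ (d : ℕ) (x : ℕ → Fin d → R),
    (∀ n, IsSystemOfParameters (x n)) →
    (∀ n, Ideal.span (Set.range (x n)) ≤ IsLocalRing.maximalIdeal R ^ n) →
    Tendsto (fun n =>
      (Module.length R (KoszulCohomology (x n) M i) : ℝ≥0∞) /
        (Module.length R (R ⧸ Ideal.span (Set.range (x n))) : ℝ≥0∞)) atTop (𝓝 0)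

/-! ### The rings and the ideals -/

/-- For elements `x_1, …, x_e` of `R`, the ideal `(x_a, x_{a+1}, …, x_b)`. The index
`j : Fin e` stands for `x_{j+1}`; the ideal is zero if `b < a`. -/
def idealOfVars {R : Type*} [CommRing R] {e : ℕ} (x : Fin e → R) (a b : ℕ) : Ideal R :=
  Ideal.span {r | ∃ j : Fin e, a ≤ (j : ℕ) + 1 ∧ (j : ℕ) + 1 ≤ b ∧ x j = r}

/-- The ring `V[[x_1, …, x_d]] / (p^s x_1)`, for `d ≥ 1`. -/
abbrev HypersurfaceRing (V : Type*) [CommRing V] (p : V) (s d : ℕ) (hd : 0 < d) : Type _ :=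
  MvPowerSeries (Fin d) V ⧸
    Ideal.span {(algebraMap V (MvPowerSeries (Fin d) V) p) ^ s *
      (MvPowerSeries.X ⟨0, hd⟩ : MvPowerSeries (Fin d) V)}

/-- The image of `x_{j+1}` in `V[[x_1, …, x_d]] / (p^s x_1)`. -/
def hypersurfaceVar (V : Type*) [CommRing V] (p : V) (s d : ℕ) (hd : 0 < d) (j : Fin d) :
    HypersurfaceRing V p s d hd :=
  Ideal.Quotient.mk _ (MvPowerSeries.X j)

instance HypersurfaceRing.isLocalRing (V : Type*) [CommRing V] [IsLocalRing V] (p : V) (s d : ℕ)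
    (hd : 0 < d) : IsLocalRing (HypersurfaceRing V p s d hd) := by
  have : Nontrivial (HypersurfaceRing V p s d hd) := by
    refine Ideal.Quotient.nontrivial_iff.mpr fun h => ?_
    rw [Ideal.span_singleton_eq_top] at h
    have h2 := (MvPowerSeries.isUnit_iff_constantCoeff.mp h)
    simp at h2
  exact IsLocalRing.of_surjective' (Ideal.Quotient.mk _) Ideal.Quotient.mk_surjective

end

/-! ### Signs, the square-zero identity and the contraction homotopy of the Koszul complex. -/

section Koszul

variable {R : Type*} [CommRing R] {d : ℕ}

/-! Let `P` be the ideal generated by `M` and, when a power of `p` is among the generators, by `p`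
itself. A sequence `y₀, ys` of length `h` is regular modulo `P`, and elements `w 0, …, w c` with `c
= d - h` lie in `P`. The parameter ideal `I` is generated by `w (i + 1) * y₀ ^ n + w i ^ (n + 1)`
for `i < c`, by `y₀ ^ N + w c ^ n` and by the `N`-th powers of `ys`. Modulo `P` it becomes `(y₀ ^ N,
y_j ^ N)`. Plain powers `w i ^ n` would have the same image, but the length of the quotient would
then be of order `n ^ c * N ^ h`. The mixed generators avoid the factor `n ^ c`.

Upper bound: a relation such as `w 0 ^ s * y₀ ^ s = 0` propagates along the chain, so `w (i + 1) *
y₀ ^ (c * n + s)` lies in `I`, and all `w i` are nilpotent modulo `I` with exponents depending on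
`n` only. Hence multiplication by a `w (i + 1)` contributes at most a constant depending on `n`
times `N ^ (h - 1)`. After killing the `w (i + 1)`, what remains has length at most `(s + 1) * N ^
h` plus a term of that smaller order. Choosing `N` large after `n` gives at most `(s + 2) * N ^ h`,
free of `n` (`ParameterData.exists_quotLength_paramIdeal_le`).

Lower bound: iterated connecting maps along the regular sequence embed `R / (P + I)` into `H^h(R /
P)`. Since `R / M` need not be `R / P`, it is placed between `R / P` and `R / (X + q' ^ (t + 1))`,
where the composite is `y₀` times an embedding that stays injective on `H^h`. Thus `H^h(R / M)` has
length at least `(N - 1) * N ^ (h - 1)` (`quotLength_le_length_koszulCohomology`). The ratio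
therefore stays above `1 / (2 * (s + 2))`.

For `M` itself, the depth of `R` exceeds `h`, so `H^h(R)` vanishes and `H^h(R / M)` embeds into
`H^(h+1)(M)`. The six cases differ only in the choice of `w`, `y₀`, `ys`, and of an extra generator
`q` of the maximal ideal, needed for `V[[x]] / (p^s x_1)`. -/

/-- The sign `(-1)^{#{l ∈ T | l < j}}`. -/
def koszulSign (R : Type*) [CommRing R] {d : ℕ} (T : Finset (Fin d)) (j : Fin d) : R :=
  (-1 : R) ^ (T.filter (fun l => l < j)).card

lemma koszulSign_mul_self (T : Finset (Fin d)) (j : Fin d) :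
    koszulSign R T j * koszulSign R T j = 1 := by
  rw [koszulSign, ← mul_pow]; simp

lemma koszulSign_erase_of_le (T : Finset (Fin d)) {j l : Fin d} (h : j ≤ l) :
    koszulSign R (T.erase l) j = koszulSign R T j := by
  unfold koszulSign
  congr 2
  ext a
  simp only [Finset.mem_filter, Finset.mem_erase]
  constructor
  · rintro ⟨⟨_, h1⟩, h2⟩; exact ⟨h1, h2⟩
  · rintro ⟨h1, h2⟩; exact ⟨⟨(lt_of_lt_of_le h2 h).ne, h1⟩, h2⟩

lemma koszulSign_erase_of_lt (T : Finset (Fin d)) {j l : Fin d} (h : j < l) (hj : j ∈ T) :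
    koszulSign R T l = - koszulSign R (T.erase j) l := by
  unfold koszulSign
  have : T.filter (fun a => a < l) = insert j ((T.erase j).filter (fun a => a < l)) := by
    ext a
    simp only [Finset.mem_filter, Finset.mem_insert, Finset.mem_erase]
    by_cases ha : a = j
    · subst ha; simp [hj, h]
    · simp [ha]
  rw [this, Finset.card_insert_of_notMem (by simp), pow_succ]
  ring

/-- Removing the smaller of two indices changes the sign at the larger one, and not conversely. Both
`δ² = 0` and the homotopy formula reduce to this. -/
lemma koszulSign_erase_comm (T : Finset (Fin d)) {j l : Fin d} (hj : j ∈ T) (hl : l ∈ T)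
    (hne : j ≠ l) :
    koszulSign R T j * koszulSign R (T.erase j) l =
      - (koszulSign R T l * koszulSign R (T.erase l) j) := by
  rcases lt_or_gt_of_ne hne with h | h
  · rw [koszulSign_erase_of_le T h.le, koszulSign_erase_of_lt T h hj]; ring
  · rw [koszulSign_erase_of_le T h.le, koszulSign_erase_of_lt T h hl]; ring

variable (x : Fin d → R) {M : Type*} [AddCommGroup M] [Module R M]

/-- The Koszul differential on all functions on finsets. -/
def koszulD (Φ : Finset (Fin d) → M) (T : Finset (Fin d)) : M :=
  ∑ j ∈ T, (koszulSign R T j * x j) • Φ (T.erase j)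

/-- Contraction against the `j`-th basis vector. -/
def koszulContract (R : Type*) [CommRing R] [Module R M] (j : Fin d) (Φ : Finset (Fin d) → M)
    (S : Finset (Fin d)) : M :=
  if j ∈ S then 0 else koszulSign R S j • Φ (insert j S)

lemma koszulD_koszulD (Φ : Finset (Fin d) → M) (T : Finset (Fin d)) :
    koszulD x (koszulD x Φ) T = 0 := by
  unfold koszulD
  simp only [Finset.smul_sum, smul_smul]
  rw [Finset.sum_sigma']
  refine Finset.sum_involution (fun a _ => ⟨a.2, a.1⟩) ?_ ?_ ?_ ?_
  · rintro ⟨j, l⟩ h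
    simp only [Finset.mem_sigma, Finset.mem_erase] at h
    obtain ⟨hj, hlj, hl⟩ := h
    have := koszulSign_erase_comm (R := R) T hj hl (Ne.symm hlj)
    rw [Finset.erase_right_comm, ← add_smul]
    convert zero_smul R _
    linear_combination (x j * x l) * this
  · rintro ⟨j, l⟩ h _
    simp only [Finset.mem_sigma, Finset.mem_erase] at h
    intro h'
    exact h.2.1 (congrArg Sigma.fst h')
  · rintro ⟨j, l⟩ h
    simp only [Finset.mem_sigma, Finset.mem_erase] at h ⊢
    exact ⟨h.2.2, Ne.symm h.2.1, h.1⟩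
  · rintro ⟨j, l⟩ h; rfl

/-- Contraction is a homotopy between multiplication by `x j` and zero. Working with functions on
all finsets keeps cardinality proofs out of the computation. -/
lemma koszulD_koszulContract (j : Fin d) (Φ : Finset (Fin d) → M) (S : Finset (Fin d)) :
    koszulD x (koszulContract R j Φ) S + koszulContract R j (koszulD x Φ) S = x j • Φ S := by
  by_cases hj : j ∈ S
  · rw [koszulContract, if_pos hj, add_zero, koszulD, Finset.sum_eq_single j]
    · rw [koszulContract, if_neg (by simp), Finset.insert_erase hj, smul_smul,
        koszulSign_erase_of_le _ le_rfl]
      congr 1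
      linear_combination x j * koszulSign_mul_self (R := R) S j
    · intro l _ hlj
      rw [koszulContract, if_pos (by simp [hj, Ne.symm hlj]), smul_zero]
    · intro h; exact absurd hj h
  · rw [koszulContract, if_neg hj]
    unfold koszulD
    rw [Finset.sum_insert hj, smul_add, add_left_comm, Finset.smul_sum, ← Finset.sum_add_distrib]
    have hS : (insert j S).erase j = S := Finset.erase_insert hj
    have h1 : koszulSign R (insert j S) j = koszulSign R S j := by
      conv_rhs => rw [← hS]
      rw [koszulSign_erase_of_le _ le_rfl]
    rw [Finset.sum_eq_zero, add_zero, hS, smul_smul, h1]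
    · congr 1
      linear_combination x j * koszulSign_mul_self (R := R) S j
    · intro l hl
      have hne : j ≠ l := fun h => hj (h ▸ hl)
      have key := koszulSign_erase_comm (R := R) (insert j S) (Finset.mem_insert_self j S)
        (Finset.mem_insert_of_mem hl) hne
      rw [hS] at key
      have h2 : koszulSign R (S.erase l) j = koszulSign R ((insert j S).erase l) j := by
        rw [← koszulSign_erase_of_le ((insert j S).erase l) (le_refl j), Finset.erase_right_comm,
          hS]
      have hins : insert j (S.erase l) = (insert j S).erase l := by
        rw [Finset.erase_insert_of_ne hne]
      rw [koszulContract, if_neg (by simp [hj]), smul_smul, smul_smul, hins, ← add_smul, h2, ← h1]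
      convert zero_smul R _
      have e1 := koszulSign_mul_self (R := R) (insert j S) j
      have e2 := koszulSign_mul_self (R := R) ((insert j S).erase l) j
      generalize koszulSign R (insert j S) j = a at *
      generalize koszulSign R (insert j S) l = b at *
      generalize koszulSign R S l = c at *
      generalize koszulSign R ((insert j S).erase l) j = e at *
      linear_combination (a * e * x l) * key + (-c * e * x l) * e1 + (-a * b * x l) * e2

/-- Extension of a cochain by zero. -/
def KoszulCochain.ext {i : ℕ} (φ : KoszulCochain d M i) (S : Finset (Fin d)) : M :=
  if h : S.card = i then φ ⟨S, h⟩ else 0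

lemma KoszulCochain.ext_apply {i : ℕ} (φ : KoszulCochain d M i) (S : {S : Finset (Fin d) // S.card = i}) :
    φ.ext S.1 = φ S := by
  rw [KoszulCochain.ext, dif_pos S.2]

lemma koszulDifferential_apply {i : ℕ} (φ : KoszulCochain d M i)
    (T : {S : Finset (Fin d) // S.card = i + 1}) :
    koszulDifferential x M i φ T = koszulD x φ.ext T.1 := by
  unfold koszulD
  rw [← Finset.sum_coe_sort]
  refine Finset.sum_congr rfl fun j _ => ?_
  rw [KoszulCochain.ext, dif_pos (by rw [Finset.card_erase_of_mem j.2, T.2]; rfl)]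
  rfl

lemma koszulDifferential_ext {i : ℕ} (φ : KoszulCochain d M i) :
    KoszulCochain.ext (koszulDifferential x M i φ) = koszulD x φ.ext := by
  funext T
  by_cases h : T.card = i + 1
  · rw [KoszulCochain.ext, dif_pos h, koszulDifferential_apply]
  · rw [KoszulCochain.ext, dif_neg h, koszulD, Finset.sum_eq_zero]
    intro j hj
    rw [KoszulCochain.ext, dif_neg, smul_zero]
    rw [Finset.card_erase_of_mem hj]
    have := Finset.card_pos.mpr ⟨j, hj⟩
    omega

lemma koszulDifferential_comp {i : ℕ} (φ : KoszulCochain d M i) :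
    koszulDifferential x M (i + 1) (koszulDifferential x M i φ) = 0 := by
  funext T
  rw [koszulDifferential_apply, koszulDifferential_ext, koszulD_koszulD]
  rfl

lemma koszulCoboundaries_le_ker (i : ℕ) :
    koszulCoboundaries x M i ≤ LinearMap.ker (koszulDifferential x M i) := by
  cases i with
  | zero => exact bot_le
  | succ i =>
    rintro _ ⟨φ, rfl⟩
    exact koszulDifferential_comp x φ

/-- By the contraction homotopy each `x j`, hence the ideal they generate, annihilates Koszul
cohomology. -/
lemma smul_mem_koszulCoboundaries {i : ℕ} {a : R} (ha : a ∈ Ideal.span (Set.range x))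
    {φ : KoszulCochain d M i} (hφ : koszulDifferential x M i φ = 0) :
    a • φ ∈ koszulCoboundaries x M i := by
  induction ha using Submodule.span_induction with
  | zero => simp
  | add a b _ _ ha hb => rw [add_smul]; exact add_mem ha hb
  | smul r a _ ha => rw [smul_eq_mul, mul_smul]; exact Submodule.smul_mem _ _ ha
  | mem a ha =>
    obtain ⟨j, rfl⟩ := ha
    have hz : koszulD x φ.ext = 0 := by
      rw [← koszulDifferential_ext, hφ]
      funext S
      unfold KoszulCochain.ext
      split_ifs <;> rfl
    have key := fun S => koszulD_koszulContract x j φ.ext S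
    rw [hz] at key
    have h0 : ∀ S, koszulContract R j (0 : Finset (Fin d) → M) S = 0 := by
      intro S; unfold koszulContract; split_ifs <;> simp
    simp only [h0, add_zero] at key
    cases i with
    | zero =>
      rw [koszulCoboundaries, Submodule.mem_bot]
      funext S
      have hS : S.1 = ∅ := Finset.card_eq_zero.mp S.2
      have := key S.1
      rw [KoszulCochain.ext_apply] at this
      rw [Pi.smul_apply, ← this, hS]
      simp [koszulD]
    | succ i =>
      refine ⟨fun S => koszulContract R j φ.ext S.1, ?_⟩
      funext T
      rw [koszulDifferential_apply, Pi.smul_apply, ← KoszulCochain.ext_apply φ T, ← key T.1]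
      congr 1
      funext S
      by_cases h : S.card = i
      · rw [KoszulCochain.ext, dif_pos h]
      · rw [KoszulCochain.ext, dif_neg h, koszulContract]
        split_ifs with hj
        · rfl
        · rw [KoszulCochain.ext, dif_neg, smul_zero]
          rw [Finset.card_insert_of_notMem hj]; omega

end Koszul

/-! ### Functoriality and the long exact sequence, in the two places where it is used. -/

section KoszulFunctor

variable {R : Type*} [CommRing R] {d : ℕ} (x : Fin d → R)
variable {A B C : Type*} [AddCommGroup A] [Module R A] [AddCommGroup B] [Module R B]
  [AddCommGroup C] [Module R C]

lemma koszulDifferential_compLeft (u : A →ₗ[R] B) {i : ℕ} (φ : KoszulCochain d A i) :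
    koszulDifferential x B i (u.compLeft _ φ) = u.compLeft _ (koszulDifferential x A i φ) := by
  funext T
  simp [koszulDifferential, map_sum]

lemma compLeft_mem_koszulCoboundaries (u : A →ₗ[R] B) {i : ℕ} {φ : KoszulCochain d A i}
    (hφ : φ ∈ koszulCoboundaries x A i) : u.compLeft _ φ ∈ koszulCoboundaries x B i := by
  cases i with
  | zero =>
    rw [koszulCoboundaries, Submodule.mem_bot] at hφ ⊢
    rw [hφ, map_zero]
  | succ i =>
    obtain ⟨ψ, rfl⟩ := hφ
    exact ⟨u.compLeft _ ψ, koszulDifferential_compLeft x u ψ⟩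

lemma exists_mem_koszulCoboundaries_compLeft {v : B →ₗ[R] C} (hv : Function.Surjective v) {i : ℕ}
    {φ : KoszulCochain d C i} (hφ : φ ∈ koszulCoboundaries x C i) :
    ∃ ψ ∈ koszulCoboundaries x B i, v.compLeft _ ψ = φ := by
  cases i with
  | zero =>
    rw [koszulCoboundaries, Submodule.mem_bot] at hφ
    exact ⟨0, zero_mem _, by rw [hφ, map_zero]⟩
  | succ i =>
    obtain ⟨θ, rfl⟩ := hφ
    obtain ⟨θ', rfl⟩ : ∃ θ', v.compLeft _ θ' = θ := hv.comp_left θ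
    exact ⟨_, ⟨θ', rfl⟩, (koszulDifferential_compLeft x v θ').symm⟩

/-- The map induced on Koszul cocycles by a linear map. -/
def koszulCocycleMap (u : A →ₗ[R] B) (i : ℕ) :
    LinearMap.ker (koszulDifferential x A i) →ₗ[R] LinearMap.ker (koszulDifferential x B i) :=
  (u.compLeft _).restrict fun φ hφ => by
    rw [LinearMap.mem_ker] at hφ ⊢
    rw [koszulDifferential_compLeft, hφ, map_zero]

/-- The map induced on Koszul cohomology by a linear map. -/
def koszulMap (u : A →ₗ[R] B) (i : ℕ) : KoszulCohomology x A i →ₗ[R] KoszulCohomology x B i :=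
  Submodule.mapQ _ _ (koszulCocycleMap x u i) fun _ hφ =>
    compLeft_mem_koszulCoboundaries x u hφ

lemma koszulMap_mk (u : A →ₗ[R] B) (i : ℕ) (φ : LinearMap.ker (koszulDifferential x A i)) :
    koszulMap x u i (Submodule.Quotient.mk φ) =
      Submodule.Quotient.mk (koszulCocycleMap x u i φ) := rfl

lemma koszulMap_comp (u : A →ₗ[R] B) (v : B →ₗ[R] C) (i : ℕ) :
    koszulMap x v i ∘ₗ koszulMap x u i = koszulMap x (v ∘ₗ u) i := by
  ext φ
  rfl

lemma koszulMap_smul (u : A →ₗ[R] B) (r : R) (i : ℕ) :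
    koszulMap x (r • u) i = r • koszulMap x u i := by
  ext φ
  rfl

/-- The Koszul cohomology of degree `i` vanishes. -/
def KoszulVanishes (A : Type*) [AddCommGroup A] [Module R A] (i : ℕ) : Prop :=
  ∀ φ : KoszulCochain d A i, koszulDifferential x A i φ = 0 → φ ∈ koszulCoboundaries x A i

variable {x}

lemma exists_compLeft_eq {u : A →ₗ[R] B} {v : B →ₗ[R] C} (huv : Function.Exact u v) {i : ℕ}
    {φ : KoszulCochain d B i} (hφ : v.compLeft _ φ = 0) : ∃ ψ, u.compLeft _ ψ = φ := by
  have h : ∀ S, ∃ a, u a = φ S := fun S => (huv _).mp (congrFun hφ S)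
  choose ψ hψ using h
  exact ⟨ψ, funext hψ⟩

lemma compLeft_compLeft_eq_zero {u : A →ₗ[R] B} {v : B →ₗ[R] C} (huv : Function.Exact u v) {i : ℕ}
    (ψ : KoszulCochain d A i) : v.compLeft _ (u.compLeft _ ψ) = 0 :=
  funext fun _ => huv.apply_apply_eq_zero _

lemma compLeft_injective {u : A →ₗ[R] B} (hu : Function.Injective u) (i : ℕ) :
    Function.Injective (u.compLeft {S : Finset (Fin d) // S.card = i}) :=
  hu.comp_left

/-- The long exact sequence at `H^i(A) → H^i(B)` when `H^{i-1}(C) = 0`. -/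
lemma koszulMap_injective {u : A →ₗ[R] B} {v : B →ₗ[R] C} (hu : Function.Injective u)
    (huv : Function.Exact u v) (hv : Function.Surjective v) {i : ℕ}
    (hC : ∀ j, j + 1 = i → KoszulVanishes x C j) : Function.Injective (koszulMap x u i) := by
  rw [← LinearMap.ker_eq_bot, Submodule.eq_bot_iff]
  intro z hz
  obtain ⟨⟨φ, hφ⟩, rfl⟩ := Submodule.Quotient.mk_surjective _ z
  rw [LinearMap.mem_ker, koszulMap_mk, Submodule.Quotient.mk_eq_zero] at hz
  rw [Submodule.Quotient.mk_eq_zero]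
  change u.compLeft _ φ ∈ koszulCoboundaries x B i at hz
  change φ ∈ koszulCoboundaries x A i
  cases i with
  | zero =>
    rw [koszulCoboundaries, Submodule.mem_bot] at hz ⊢
    exact compLeft_injective hu 0 (by rw [hz, map_zero])
  | succ i =>
    obtain ⟨ψ, hψ⟩ := hz
    -- The cocycle `v ψ` is a coboundary of `C` and lifts to a coboundary `β` of `B`. Then `ψ - β`
    -- comes from `A`, and its preimage bounds `φ`.
    have h1 : koszulDifferential x C i (v.compLeft _ ψ) = 0 := by
      rw [koszulDifferential_compLeft, hψ, compLeft_compLeft_eq_zero huv]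
    obtain ⟨β, hβ, hβ'⟩ := exists_mem_koszulCoboundaries_compLeft x hv (hC i rfl _ h1)
    obtain ⟨α, hα⟩ := exists_compLeft_eq huv (φ := ψ - β) (by rw [map_sub, hβ', sub_self])
    refine ⟨α, compLeft_injective hu _ ?_⟩
    rw [← koszulDifferential_compLeft, hα, map_sub, hψ,
      LinearMap.mem_ker.mp (koszulCoboundaries_le_ker x i hβ), sub_zero]

/-- This produces the connecting map without choosing lifts: `D` is a common source for both
cohomology modules. -/
lemma exists_linearMap_injective_of_ker_eq {D X Y : Type*} [AddCommGroup D] [Module R D]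
    [AddCommGroup X] [Module R X] [AddCommGroup Y] [Module R Y] (α : D →ₗ[R] X) (β : D →ₗ[R] Y)
    (hα : Function.Surjective α) (h : LinearMap.ker α = LinearMap.ker β) :
    ∃ γ : X →ₗ[R] Y, Function.Injective γ := by
  refine ⟨(LinearMap.ker α).liftQ β h.le ∘ₗ (α.quotKerEquivOfSurjective hα).symm.toLinearMap, ?_⟩
  rw [LinearMap.coe_comp]
  refine Function.Injective.comp ?_ (LinearEquiv.injective _)
  rw [← LinearMap.ker_eq_bot]
  exact Submodule.ker_liftQ_eq_bot _ _ _ h.ge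

/-- The connecting map `H^i(C) → H^{i+1}(A)` is injective when `H^i(B) = 0`. -/
lemma exists_koszulConnecting_injective {u : A →ₗ[R] B} {v : B →ₗ[R] C}
    (hu : Function.Injective u) (huv : Function.Exact u v) (hv : Function.Surjective v) {i : ℕ}
    (hB : KoszulVanishes x B i) :
    ∃ γ : KoszulCohomology x C i →ₗ[R] KoszulCohomology x A (i + 1), Function.Injective γ := by
  let uc : KoszulCochain d A (i + 1) →ₗ[R] KoszulCochain d B (i + 1) := u.compLeft _
  have huc : Function.Injective uc := compLeft_injective hu _
  -- `D` consists of the cochains of `B` whose differential comes from `A`. It maps onto the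
  -- cocycles of `C` by `v` and to those of `A` by the differential.
  let D : Submodule R (KoszulCochain d B i) :=
    (LinearMap.range uc).comap (koszulDifferential x B i)
  let α₀ : D →ₗ[R] LinearMap.ker (koszulDifferential x C i) :=
    LinearMap.codRestrict _ (v.compLeft _ ∘ₗ D.subtype) fun b => by
      obtain ⟨a, ha⟩ := b.2
      rw [LinearMap.mem_ker, LinearMap.comp_apply, koszulDifferential_compLeft,
        Submodule.subtype_apply, ← ha]
      exact compLeft_compLeft_eq_zero huv a
  let β₁ : D →ₗ[R] LinearMap.range uc :=
    LinearMap.codRestrict _ (koszulDifferential x B i ∘ₗ D.subtype) fun b => b.2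
  let e := LinearEquiv.ofInjective uc huc
  have he : ∀ b : D, uc (e.symm (β₁ b)) = koszulDifferential x B i b := fun b =>
    congrArg Subtype.val (e.apply_symm_apply (β₁ b))
  let β₀ : D →ₗ[R] LinearMap.ker (koszulDifferential x A (i + 1)) :=
    LinearMap.codRestrict _ (e.symm.toLinearMap ∘ₗ β₁) fun b => by
      rw [LinearMap.mem_ker]
      apply compLeft_injective hu
      rw [← koszulDifferential_compLeft, map_zero]
      change koszulDifferential x B (i + 1) (uc (e.symm (β₁ b))) = 0
      rw [he, koszulDifferential_comp]
  refine exists_linearMap_injective_of_ker_eq (Submodule.mkQ _ ∘ₗ α₀) (Submodule.mkQ _ ∘ₗ β₀) ?_ ?_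
  · intro z
    obtain ⟨⟨φ, hφ⟩, rfl⟩ := Submodule.Quotient.mk_surjective _ z
    obtain ⟨b, hb⟩ : ∃ b, v.compLeft _ b = φ := hv.comp_left φ
    have hbD : b ∈ D := by
      refine exists_compLeft_eq huv ?_
      rw [← koszulDifferential_compLeft, hb, LinearMap.mem_ker.mp hφ]
    refine ⟨⟨b, hbD⟩, ?_⟩
    change Submodule.Quotient.mk _ = _
    congr 1
    exact Subtype.ext hb
  · ext b
    rw [LinearMap.mem_ker, LinearMap.mem_ker, LinearMap.comp_apply, LinearMap.comp_apply,
      Submodule.mkQ_apply, Submodule.mkQ_apply, Submodule.Quotient.mk_eq_zero,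
      Submodule.Quotient.mk_eq_zero]
    change v.compLeft _ b.1 ∈ koszulCoboundaries x C i ↔
      e.symm (β₁ b) ∈ koszulCoboundaries x A (i + 1)
    constructor
    · intro h
      obtain ⟨b', hb', hvb'⟩ := exists_mem_koszulCoboundaries_compLeft x hv h
      obtain ⟨a, ha⟩ := exists_compLeft_eq huv (φ := b.1 - b') (by rw [map_sub, hvb', sub_self])
      refine ⟨a, huc ?_⟩
      rw [he]
      change u.compLeft _ _ = _
      rw [← koszulDifferential_compLeft, ha, map_sub,
        LinearMap.mem_ker.mp (koszulCoboundaries_le_ker x i hb'), sub_zero]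
    -- Only this inclusion of kernels uses `H^i(B) = 0`: the corrected cochain `b - u a` is a
    -- cocycle of `B`, hence a coboundary.
    · rintro ⟨a, ha⟩
      have h1 : koszulDifferential x B i (b.1 - u.compLeft _ a) = 0 := by
        rw [map_sub, koszulDifferential_compLeft, ha, sub_eq_zero]
        exact (he b).symm
      have h2 := compLeft_mem_koszulCoboundaries x v (hB _ h1)
      rwa [map_sub, compLeft_compLeft_eq_zero huv, sub_zero] at h2

/-- If `a` lies in the ideal of the sequence and is regular on `B` with quotient `C = B / a B`,
then `H^{i-1}(C) = 0` implies `H^i(B) = 0`. -/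
lemma KoszulVanishes.of_regular {a : R} (ha : a ∈ Ideal.span (Set.range x))
    (hreg : ∀ b : B, a • b = 0 → b = 0) {v : B →ₗ[R] C} (hv : Function.Surjective v)
    (hker : Function.Exact (LinearMap.lsmul R B a) v) {i : ℕ}
    (hC : ∀ j, j + 1 = i → KoszulVanishes x C j) : KoszulVanishes x B i := by
  intro φ hφ
  have hinj : Function.Injective (LinearMap.lsmul R B a) :=
    (injective_iff_map_eq_zero _).mpr hreg
  -- Multiplication by `a` on `H^i(B)` is injective here, and it is zero because `a` lies in the
  -- ideal.
  have h := koszulMap_injective (x := x) hinj hker hv hC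
  have h2 : koszulMap x (LinearMap.lsmul R B a) i (Submodule.Quotient.mk ⟨φ, hφ⟩) = 0 := by
    rw [koszulMap_mk, Submodule.Quotient.mk_eq_zero]
    exact smul_mem_koszulCoboundaries x ha hφ
  have h3 := h (h2.trans (map_zero _).symm)
  rw [Submodule.Quotient.mk_eq_zero] at h3
  exact h3

/-- A module annihilated by the sequence embeds into its zeroth Koszul cohomology. -/
lemma exists_injective_koszulCohomology_zero (hx : ∀ j, ∀ b : B, x j • b = 0) :
    ∃ γ : B →ₗ[R] KoszulCohomology x B 0, Function.Injective γ := by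
  let γ₀ : B →ₗ[R] LinearMap.ker (koszulDifferential x B 0) :=
    LinearMap.codRestrict _ (LinearMap.pi fun _ => LinearMap.id) fun b => by
      rw [LinearMap.mem_ker]
      funext T
      simp [koszulDifferential, mul_smul, hx]
  refine ⟨Submodule.mkQ _ ∘ₗ γ₀, (injective_iff_map_eq_zero _).mpr fun b hb => ?_⟩
  rw [LinearMap.comp_apply, Submodule.mkQ_apply, Submodule.Quotient.mk_eq_zero] at hb
  have hb' : (fun _ => b : KoszulCochain d B 0) = 0 := hb
  exact congrFun hb' ⟨∅, rfl⟩

end KoszulFunctor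

/-! ### Weakly regular sequences modulo an ideal. -/

section SeqReg

variable {R : Type*} [CommRing R]

/-- `a` is a nonzerodivisor modulo `J`. -/
def RegularMod (J : Ideal R) (a : R) : Prop := ∀ r, a * r ∈ J → r ∈ J

/-- A list is a (weakly) regular sequence modulo `J`. -/
def SeqReg : Ideal R → List R → Prop
  | _, [] => True
  | J, a :: l => RegularMod J a ∧ SeqReg (J ⊔ Ideal.span {a}) l

lemma mem_sup_span_singleton_iff {J : Ideal R} {a r : R} :
    r ∈ J ⊔ Ideal.span {a} ↔ ∃ t, r - a * t ∈ J := by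
  rw [sup_comm, Ideal.mem_span_singleton_sup]
  constructor
  · rintro ⟨t, j, hj, rfl⟩
    exact ⟨t, by convert hj using 1; ring⟩
  · rintro ⟨t, ht⟩
    exact ⟨t, _, ht, by ring⟩

lemma RegularMod.mul {J : Ideal R} {a b : R} (ha : RegularMod J a) (hb : RegularMod J b) :
    RegularMod J (a * b) := fun r hr => hb _ (ha _ (by rwa [← mul_assoc]))

lemma RegularMod.pow {J : Ideal R} {a : R} (ha : RegularMod J a) (e : ℕ) :
    RegularMod J (a ^ e) := by
  induction e with
  | zero => intro r hr; simpa using hr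
  | succ e ih => rw [pow_succ]; exact ih.mul ha

/-- This half of permuting a regular sequence holds over any commutative ring; regularity of `b`
modulo `J` is not claimed. -/
lemma RegularMod.swap {J : Ideal R} {u b : R} (hu : RegularMod J u)
    (hb : RegularMod (J ⊔ Ideal.span {u}) b) : RegularMod (J ⊔ Ideal.span {b}) u := by
  intro r hr
  obtain ⟨t, ht⟩ := mem_sup_span_singleton_iff.mp hr
  have h1 : b * t ∈ J ⊔ Ideal.span {u} :=
    mem_sup_span_singleton_iff.mpr ⟨r, by convert J.neg_mem ht using 1; ring⟩
  obtain ⟨t', ht'⟩ := mem_sup_span_singleton_iff.mp (hb _ h1)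
  refine mem_sup_span_singleton_iff.mpr ⟨t', hu _ ?_⟩
  have := J.add_mem ht (J.mul_mem_left b ht')
  convert this using 1; ring

/-- As `u` is regular modulo `J`, `R / (J + uv)` is an extension of `R / (J + u)` by `R / (J + v)`,
and an element regular on both ends is regular in the middle. -/
lemma RegularMod.sup_mul {J : Ideal R} {u v b : R} (hu : RegularMod J u)
    (hbu : RegularMod (J ⊔ Ideal.span {u}) b) (hbv : RegularMod (J ⊔ Ideal.span {v}) b) :
    RegularMod (J ⊔ Ideal.span {u * v}) b := by
  intro f hf
  obtain ⟨w, hw⟩ := mem_sup_span_singleton_iff.mp hf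
  have h1 : b * f ∈ J ⊔ Ideal.span {u} :=
    mem_sup_span_singleton_iff.mpr ⟨v * w, by convert hw using 1; ring⟩
  obtain ⟨g, hg⟩ := mem_sup_span_singleton_iff.mp (hbu _ h1)
  have h2 : b * g - v * w ∈ J := hu _ (by
    have := J.sub_mem hw (J.mul_mem_left b hg)
    convert this using 1; ring)
  obtain ⟨k, hk⟩ := mem_sup_span_singleton_iff.mp
    (hbv g (mem_sup_span_singleton_iff.mpr ⟨w, h2⟩))
  refine mem_sup_span_singleton_iff.mpr ⟨k, ?_⟩
  have := J.add_mem hg (J.mul_mem_left u hk)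
  convert this using 1; ring

lemma sup_span_singleton_comm (J : Ideal R) (a b : R) :
    J ⊔ Ideal.span {a} ⊔ Ideal.span {b} = J ⊔ Ideal.span {b} ⊔ Ideal.span {a} :=
  sup_right_comm _ _ _

lemma SeqReg.sup_mul {l : List R} : ∀ {J : Ideal R} {u v : R}, RegularMod J u →
    SeqReg (J ⊔ Ideal.span {u}) l → SeqReg (J ⊔ Ideal.span {v}) l →
    SeqReg (J ⊔ Ideal.span {u * v}) l := by
  induction l with
  | nil => intros; trivial
  | cons b l ih =>
    rintro J u v hu ⟨h1, h1'⟩ ⟨h2, h2'⟩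
    refine ⟨hu.sup_mul h1 h2, ?_⟩
    rw [sup_span_singleton_comm] at h1' h2' ⊢
    exact ih (hu.swap h1) h1' h2'

lemma SeqReg.top (l : List R) : SeqReg (⊤ : Ideal R) l := by
  induction l with
  | nil => trivial
  | cons b l ih => exact ⟨fun _ _ => trivial, by rwa [top_sup_eq]⟩

lemma SeqReg.sup_pow {J : Ideal R} {u : R} {l : List R} (hu : RegularMod J u)
    (h : SeqReg (J ⊔ Ideal.span {u}) l) (e : ℕ) : SeqReg (J ⊔ Ideal.span {u ^ e}) l := by
  induction e with
  | zero =>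
    rw [pow_zero, Ideal.span_singleton_one, sup_top_eq]
    exact SeqReg.top l
  | succ e ih => rw [pow_succ']; exact SeqReg.sup_mul hu h ih

lemma SeqReg.cons_pow {J : Ideal R} {u : R} {l : List R} (h : SeqReg J (u :: l)) (e : ℕ) :
    SeqReg J (u ^ e :: l) :=
  ⟨h.1.pow e, SeqReg.sup_pow h.1 h.2 e⟩

lemma SeqReg.map_pow {l : List R} (e : ℕ) : ∀ {J : Ideal R}, SeqReg J l →
    SeqReg J (l.map (· ^ e)) := by
  induction l with
  | nil => intros; trivial
  | cons b l ih => intro J h; exact ⟨(h.cons_pow e).1, ih (h.cons_pow e).2⟩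

/-- Repeated swapping moves the first element of a regular sequence to the end. -/
lemma RegularMod.sup_ofList {l : List R} : ∀ {J : Ideal R} {u : R}, RegularMod J u →
    SeqReg (J ⊔ Ideal.span {u}) l → RegularMod (J ⊔ Ideal.ofList l) u := by
  induction l with
  | nil => intro J u hu _; simpa using hu
  | cons b l ih =>
    rintro J u hu ⟨h1, h2⟩
    rw [Ideal.ofList_cons, ← sup_assoc]
    exact ih (hu.swap h1) (by rwa [sup_span_singleton_comm])

/-- Transport of regular sequences to a quotient ring. -/
lemma SeqReg.map_mk (K : Ideal R) {l : List R} : ∀ {J : Ideal R}, SeqReg (J ⊔ K) l →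
    SeqReg (J.map (Ideal.Quotient.mk K)) (l.map (Ideal.Quotient.mk K)) := by
  have key : ∀ (J : Ideal R) (r : R),
      Ideal.Quotient.mk K r ∈ J.map (Ideal.Quotient.mk K) ↔ r ∈ J ⊔ K := by
    intro J r
    rw [← Ideal.mem_comap, Ideal.comap_map_of_surjective _ Ideal.Quotient.mk_surjective,
      ← RingHom.ker_eq_comap_bot, Ideal.mk_ker]
  induction l with
  | nil => intros; trivial
  | cons b l ih =>
    rintro J ⟨h1, h2⟩
    refine ⟨?_, ?_⟩
    · intro r hr
      obtain ⟨r, rfl⟩ := Ideal.Quotient.mk_surjective r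
      rw [← map_mul] at hr
      exact (key _ _).mpr (h1 _ ((key _ _).mp hr))
    · have := ih (J := J ⊔ Ideal.span {b}) (by rwa [sup_right_comm])
      rwa [Ideal.map_sup, Ideal.map_span, Set.image_singleton] at this

end SeqReg

/-! ### Lengths of cyclic modules modulo powers of elements. -/

section Length

variable {R : Type*} [CommRing R]

/-- The length of `R / J`. -/
noncomputable def quotLength (J : Ideal R) : ℕ∞ := Module.length R (R ⧸ J)

lemma length_quotient_anti {I J : Ideal R} (h : I ≤ J) :
    quotLength J ≤ quotLength I :=
  Module.length_le_of_surjective (Submodule.factor h) (Submodule.factor_surjective h)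

/-- Multiplication by `x`, as a map `R / J → R / I`. -/
def quotientMul {I J : Ideal R} (x : R) (h : ∀ r ∈ J, x * r ∈ I) : (R ⧸ J) →ₗ[R] (R ⧸ I) :=
  Submodule.mapQ J I (LinearMap.lsmul R R x) h

lemma quotientMul_mk {I J : Ideal R} (x : R) (h : ∀ r ∈ J, x * r ∈ I) (r : R) :
    quotientMul x h (Submodule.Quotient.mk r) = Submodule.Quotient.mk (x * r) := rfl

lemma quotientMul_injective {I J : Ideal R} (x : R) (h : ∀ r ∈ J, x * r ∈ I)
    (h' : ∀ r, x * r ∈ I → r ∈ J) : Function.Injective (quotientMul x h) := by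
  rw [injective_iff_map_eq_zero]
  intro z hz
  obtain ⟨r, rfl⟩ := Submodule.Quotient.mk_surjective _ z
  rw [quotientMul_mk, Submodule.Quotient.mk_eq_zero] at hz
  rw [Submodule.Quotient.mk_eq_zero]
  exact h' r hz

lemma quotientMul_exact {I J K : Ideal R} (x : R) (h : ∀ r ∈ J, x * r ∈ I)
    (hK : K = I ⊔ Ideal.span {x}) :
    Function.Exact (quotientMul x h) (Submodule.factor (hK ▸ le_sup_left : I ≤ K)) := by
  subst hK
  intro z
  obtain ⟨r, rfl⟩ := Submodule.Quotient.mk_surjective _ z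
  rw [show Submodule.factor (le_sup_left : I ≤ I ⊔ Ideal.span {x}) (Submodule.Quotient.mk r) =
    Submodule.Quotient.mk r from rfl, Submodule.Quotient.mk_eq_zero, mem_sup_span_singleton_iff]
  constructor
  · rintro ⟨t, ht⟩
    refine ⟨Submodule.Quotient.mk t, ?_⟩
    rw [quotientMul_mk, Eq.comm, Submodule.Quotient.eq]
    exact ht
  · rintro ⟨t, ht⟩
    obtain ⟨t, rfl⟩ := Submodule.Quotient.mk_surjective _ t
    rw [quotientMul_mk, Eq.comm, Submodule.Quotient.eq] at ht
    exact ⟨t, ht⟩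

lemma length_quotient_eq {I J : Ideal R} (x : R) (h : ∀ r ∈ J, x * r ∈ I)
    (h' : ∀ r, x * r ∈ I → r ∈ J) :
    quotLength I =
      quotLength J + quotLength (I ⊔ Ideal.span {x}) :=
  Module.length_eq_add_of_exact _ _ (quotientMul_injective x h h')
    (Submodule.factor_surjective _) (quotientMul_exact x h rfl)

/-- The exact first term is `R / (I : x)`, and `J` is contained in `I : x`. -/
lemma length_quotient_le {I J : Ideal R} (x : R) (h : ∀ r ∈ J, x * r ∈ I) :
    quotLength I ≤
      quotLength J + quotLength (I ⊔ Ideal.span {x}) := by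
  let J' : Ideal R := Submodule.comap (LinearMap.lsmul R R x) I
  rw [length_quotient_eq (J := J') x (fun r hr => hr) (fun r hr => hr)]
  gcongr
  exact length_quotient_anti h

lemma length_quotient_sup_mul_le (J : Ideal R) (u v : R) :
    quotLength (J ⊔ Ideal.span {u * v}) ≤
      quotLength (J ⊔ Ideal.span {u}) + quotLength (J ⊔ Ideal.span {v}) := by
  rw [add_comm]
  refine (length_quotient_le (J := J ⊔ Ideal.span {v}) u ?_).trans ?_
  · intro r hr
    obtain ⟨t, ht⟩ := mem_sup_span_singleton_iff.mp hr
    refine mem_sup_span_singleton_iff.mpr ⟨t, ?_⟩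
    convert J.mul_mem_left u ht using 1; ring
  · gcongr
    exact length_quotient_anti (sup_le_sup_right le_sup_left _)

lemma length_quotient_top : quotLength (⊤ : Ideal R) = 0 := by
  rw [quotLength, Module.length_eq_zero_iff]
  exact Ideal.Quotient.subsingleton_iff.mpr rfl

lemma length_quotient_sup_pow_le (J : Ideal R) (u : R) (e : ℕ) :
    quotLength (J ⊔ Ideal.span {u ^ e}) ≤
      e * quotLength (J ⊔ Ideal.span {u}) := by
  induction e with
  | zero =>
    rw [pow_zero, Ideal.span_singleton_one, sup_top_eq, length_quotient_top]
    simp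
  | succ e ih =>
    rw [pow_succ, Nat.cast_succ, add_mul, one_mul]
    exact (length_quotient_sup_mul_le _ _ _).trans (by gcongr)

/-- Filtering by the powers of one element of `l` at a time costs a factor `e`; no regularity is
required for this direction. -/
lemma length_quotient_sup_ofList_pow_le (e : ℕ) (l : List R) : ∀ J : Ideal R,
    quotLength (J ⊔ Ideal.ofList (l.map (· ^ e))) ≤
      (e : ℕ∞) ^ l.length * quotLength (J ⊔ Ideal.ofList l) := by
  induction l with
  | nil => intro J; simp
  | cons b l ih =>
    intro J
    rw [List.map_cons, Ideal.ofList_cons, Ideal.ofList_cons, ← sup_assoc, ← sup_assoc,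
      List.length_cons, pow_succ, mul_assoc]
    refine (ih _).trans ?_
    gcongr
    rw [sup_right_comm J (Ideal.span {b}) (Ideal.ofList l),
      sup_right_comm J (Ideal.span {b ^ e}) (Ideal.ofList l)]
    exact length_quotient_sup_pow_le _ _ _

/-- For regular `u` the filtration by powers of `u` has `e` subquotients, each isomorphic to `R / (J
+ u)`. -/
lemma length_quotient_sup_pow {J : Ideal R} {u : R} (hu : RegularMod J u) (e : ℕ) :
    e * quotLength (J ⊔ Ideal.span {u}) ≤
      quotLength (J ⊔ Ideal.span {u ^ e}) := by
  induction e with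
  | zero => simp
  | succ e ih =>
    rw [length_quotient_eq (I := J ⊔ Ideal.span {u ^ (e + 1)}) (J := J ⊔ Ideal.span {u ^ e}) u,
      Nat.cast_succ, add_mul, one_mul]
    · gcongr
      refine length_quotient_anti (sup_le (sup_le le_sup_left ?_) le_sup_right)
      rw [Ideal.span_singleton_le_iff_mem, pow_succ']
      exact Ideal.mul_mem_right _ _ (Ideal.mem_sup_right (Ideal.mem_span_singleton_self u))
    · intro r hr
      obtain ⟨t, ht⟩ := mem_sup_span_singleton_iff.mp hr
      refine mem_sup_span_singleton_iff.mpr ⟨t, ?_⟩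
      convert J.mul_mem_left u ht using 1; ring
    · intro r hr
      obtain ⟨t, ht⟩ := mem_sup_span_singleton_iff.mp hr
      refine mem_sup_span_singleton_iff.mpr ⟨t, hu _ ?_⟩
      convert ht using 1; ring

lemma length_quotient_sup_ofList_pow {l : List R} (e : ℕ) : ∀ {J : Ideal R}, SeqReg J l →
    (e : ℕ∞) ^ l.length * quotLength (J ⊔ Ideal.ofList l) ≤
    quotLength (J ⊔ Ideal.ofList (l.map (· ^ e))) := by
  induction l with
  | nil => intro J; simp
  | cons b l ih =>
    intro J h
    rw [List.map_cons, Ideal.ofList_cons, Ideal.ofList_cons, ← sup_assoc, ← sup_assoc,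
      List.length_cons, pow_succ, mul_assoc]
    refine le_trans ?_ (ih (h.cons_pow e).2)
    gcongr
    rw [sup_right_comm J (Ideal.span {b}) (Ideal.ofList l),
      sup_right_comm J (Ideal.span {b ^ e}) (Ideal.ofList l)]
    exact length_quotient_sup_pow (h.1.sup_ofList h.2) _

end Length

/-! ### Koszul cohomology of cyclic modules with a regular sequence. -/

section Koszul

variable {R : Type*} [CommRing R] {d : ℕ} {x : Fin d → R}

lemma exact_lsmul_factor (J : Ideal R) (a : R) :
    Function.Exact (LinearMap.lsmul R (R ⧸ J) a)
      (Submodule.factor (le_sup_left : J ≤ J ⊔ Ideal.span {a})) := by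
  have h := quotientMul_exact (I := J) (J := J) a (fun r hr => J.mul_mem_left a hr) rfl
  have : LinearMap.lsmul R (R ⧸ J) a = quotientMul a (fun r hr => J.mul_mem_left a hr) := by
    ext; rfl
  rwa [this]

lemma RegularMod.smul_eq_zero {J : Ideal R} {a : R} (h : RegularMod J a) (b : R ⧸ J)
    (hb : a • b = 0) : b = 0 := by
  obtain ⟨r, rfl⟩ := Submodule.Quotient.mk_surjective _ b
  rw [← Submodule.Quotient.mk_smul, Submodule.Quotient.mk_eq_zero] at hb
  rw [Submodule.Quotient.mk_eq_zero]
  exact h r hb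

/-- A module of depth at least `l.length` has no Koszul cohomology below that degree. -/
lemma SeqReg.koszulVanishes {l : List R} : ∀ {J : Ideal R}, SeqReg J l →
    (∀ a ∈ l, a ∈ (Ideal.span (Set.range x)).radical) →
    ∀ i < l.length, KoszulVanishes x (R ⧸ J) i := by
  induction l with
  | nil => intro J _ _ i hi; simp at hi
  | cons a l ih =>
    intro J h hl i hi
    -- A power of `a` lies in the ideal itself, and a regular sequence stays regular after raising
    -- its head to a power.
    obtain ⟨e, he⟩ := hl a (by simp)
    have h' := h.cons_pow e
    refine KoszulVanishes.of_regular he h'.1.smul_eq_zero (Submodule.factor_surjective le_sup_left)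
      (exact_lsmul_factor J (a ^ e)) ?_
    rintro j rfl
    exact ih h'.2 (fun b hb => hl b (by simp [hb])) j (by simpa using hi)

lemma SeqReg.koszulVanishes_self {l : List R} (h : SeqReg (⊥ : Ideal R) l)
    (hl : ∀ a ∈ l, a ∈ (Ideal.span (Set.range x)).radical) {i : ℕ} (hi : i < l.length) :
    KoszulVanishes x R i := by
  intro φ hφ
  let u := (Submodule.quotEquivOfEqBot (⊥ : Ideal R) rfl)
  have h1 := h.koszulVanishes hl i hi (u.symm.toLinearMap.compLeft _ φ)
    (by rw [koszulDifferential_compLeft, hφ, map_zero])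
  have h2 := compLeft_mem_koszulCoboundaries x u.toLinearMap h1
  convert h2 using 1
  funext S
  simp

/-- A regular sequence in the ideal gives an embedding of `H^0` of the quotient. -/
lemma SeqReg.exists_injective_koszulCohomology {l : List R} : ∀ {J : Ideal R}, SeqReg J l →
    (∀ a ∈ l, a ∈ Ideal.span (Set.range x)) →
    ∃ γ : KoszulCohomology x (R ⧸ (J ⊔ Ideal.ofList l)) 0 →ₗ[R]
      KoszulCohomology x (R ⧸ J) l.length, Function.Injective γ := by
  induction l with
  | nil =>
    intro J _ _
    have : J ⊔ Ideal.ofList [] = J := by simp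
    rw [this]
    exact ⟨LinearMap.id, fun _ _ h => h⟩
  | cons a l ih =>
    intro J h hl
    obtain ⟨γ, hγ⟩ := ih h.2 (fun b hb => hl b (by simp [hb]))
    -- `a :: l` has one element more than `l`, so the cohomology of `R / J` vanishes in degree
    -- `l.length`, which is exactly what makes the connecting map injective.
    obtain ⟨δ, hδ⟩ := exists_koszulConnecting_injective (x := x) (i := l.length)
      ((injective_iff_map_eq_zero _).mpr h.1.smul_eq_zero) (exact_lsmul_factor J a)
      (Submodule.factor_surjective le_sup_left)
      (h.koszulVanishes (fun b hb => Ideal.le_radical (hl b hb)) _ (by simp))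
    rw [Ideal.ofList_cons, ← sup_assoc]
    exact ⟨δ ∘ₗ γ, hδ.comp hγ⟩

end Koszul

/-! ### The parameter ideals and the upper bound for their colength. -/

section Parameters

variable {R : Type*} [CommRing R]

/-- The generators `w_{i+1} y₀^n + w_i^{n+1}` for `i < c`, `y₀^N + w_c^n` and `y_j^N`. -/
def paramGens (c n N : ℕ) (w : ℕ → R) (y₀ : R) (ys : List R) : List R :=
  (List.range c).map (fun i => w (i + 1) * y₀ ^ n + w i ^ (n + 1)) ++
    ((y₀ ^ N + w c ^ n) :: ys.map (· ^ N))

/-- The ideal generated by `paramGens`. -/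
def paramIdeal (c n N : ℕ) (w : ℕ → R) (y₀ : R) (ys : List R) : Ideal R :=
  Ideal.ofList (paramGens c n N w y₀ ys)

lemma mem_ofList_of_mem {l : List R} {a : R} (h : a ∈ l) : a ∈ Ideal.ofList l :=
  Ideal.subset_span h

lemma map_pow_ofList_le {l : List R} {J : Ideal R} {e : ℕ} (h : ∀ a ∈ l, a ^ e ∈ J) :
    Ideal.ofList (l.map (· ^ e)) ≤ J := by
  rw [Ideal.ofList, Ideal.span_le]
  intro r hr
  obtain ⟨a, ha, rfl⟩ := List.mem_map.mp hr
  exact h a ha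

lemma pow_mem_of_pow_mem_of_le {J : Ideal R} {a : R} {e e' : ℕ} (h : a ^ e ∈ J) (he : e ≤ e') :
    a ^ e' ∈ J := by
  obtain ⟨k, rfl⟩ := Nat.exists_eq_add_of_le he
  rw [pow_add]
  exact Ideal.mul_mem_right _ _ h

variable {c n N s : ℕ} {w : ℕ → R} {y₀ q : R} {ys : List R}

lemma chain_mem_paramIdeal {i : ℕ} (hi : i < c) :
    w (i + 1) * y₀ ^ n + w i ^ (n + 1) ∈ paramIdeal c n N w y₀ ys :=
  mem_ofList_of_mem (List.mem_append_left _ (List.mem_map.mpr ⟨i, List.mem_range.mpr hi, rfl⟩))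

lemma head_mem_paramIdeal : y₀ ^ N + w c ^ n ∈ paramIdeal c n N w y₀ ys :=
  mem_ofList_of_mem (List.mem_append_right _ (by simp))

lemma pow_mem_paramIdeal {a : R} (ha : a ∈ ys) : a ^ N ∈ paramIdeal c n N w y₀ ys :=
  mem_ofList_of_mem (List.mem_append_right _
    (List.mem_cons_of_mem _ (List.mem_map.mpr ⟨a, ha, rfl⟩)))

variable (R) in
/-- Elements of a local ring to which the construction of parameter ideals applies. -/
structure ParameterData [IsLocalRing R] (c s : ℕ) (w : ℕ → R) (y₀ q : R) (ys : List R) : Prop where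
  one_le : 1 ≤ c
  -- The element `q` is a generator of the maximal ideal without its own parameter. This relation
  -- limits its contribution to the leading term to a factor `s + 1`.
  pow_mul_pow_mem : q ^ (s + 1) * y₀ ^ s ∈ Ideal.span {w 1}
  -- This starts the induction along the chain: it kills the tail `w 0 ^ (n + 1)` of the first
  -- generator after multiplication by `y₀ ^ s`.
  pow_mul_pow_eq_zero : w 0 ^ s * y₀ ^ s = 0
  pow_mem : q ^ (s + 1) ∈ Ideal.span {w 0} ⊔ Ideal.span {w 1}
  maximalIdeal_eq : Ideal.ofList ((List.range c).map fun i => w (i + 1)) ⊔ Ideal.ofList ys ⊔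
    Ideal.span {y₀} ⊔ Ideal.span {q} = IsLocalRing.maximalIdeal R
  zero_mem : w 0 ∈ IsLocalRing.maximalIdeal R

namespace ParameterData

variable [IsLocalRing R] (D : ParameterData R c s w y₀ q ys)
include D

/-- Induction up the chain: multiplying a generator by the previous power of `y₀` puts its tail `w i
^ (n + 1)` into the ideal, leaving the term with `w (i + 1)`. Each link costs `n` further powers of
`y₀`. -/
lemma mul_pow_mem (hsn : s ≤ n) {i : ℕ} (hi : i < c) :
    w (i + 1) * y₀ ^ ((i + 1) * n + s) ∈ paramIdeal c n N w y₀ ys := by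
  induction i with
  | zero =>
    have h := Ideal.mul_mem_left _ (y₀ ^ s)
      (chain_mem_paramIdeal (n := n) (N := N) (w := w) (y₀ := y₀) (ys := ys) hi)
    have h0 := D.pow_mul_pow_eq_zero
    obtain ⟨k, rfl⟩ := Nat.exists_eq_add_of_le hsn
    convert h using 1
    linear_combination (- w 0 ^ (k + 1)) * h0
  | succ i ih =>
    have h := Ideal.mul_mem_left _ (y₀ ^ ((i + 1) * n + s))
      (chain_mem_paramIdeal (n := n) (N := N) (w := w) (y₀ := y₀) (ys := ys) hi)
    have h' := Ideal.mul_mem_left _ (w (i + 1) ^ n) (ih (by omega))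
    convert Ideal.sub_mem _ h h' using 1
    ring

lemma mul_pow_mem' (hsn : s ≤ n) {i K : ℕ} (hi : i < c) (hK : c * n + s ≤ K) :
    w (i + 1) * y₀ ^ K ∈ paramIdeal c n N w y₀ ys := by
  have h : (i + 1) * n + s ≤ K := by
    have : (i + 1) * n ≤ c * n := Nat.mul_le_mul_right _ hi
    omega
  obtain ⟨k, rfl⟩ := Nat.exists_eq_add_of_le h
  rw [pow_add, ← mul_assoc]
  exact Ideal.mul_mem_right _ _ (D.mul_pow_mem hsn hi)

/-- Induction down the chain. At the top `w c * y₀ ^ N` is in the ideal, so `w c ^ (n + 1)` is too;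
below, `w i ^ (n + 1)` is a multiple of `w (i + 1)` modulo the ideal. The exponents do not involve
`N`. -/
lemma chain_pow_mem (hsn : s ≤ n) (hN : c * n + s ≤ N) {i : ℕ} (hi : i ≤ c) :
    w i ^ ((n + 1) ^ (c + 1 - i)) ∈ paramIdeal c n N w y₀ ys := by
  induction hi using Nat.decreasingInduction with
  | self =>
    obtain ⟨k, rfl⟩ := Nat.exists_eq_add_of_le' D.one_le
    rw [show k + 1 + 1 - (k + 1) = 1 by omega, pow_one]
    have h1 := Ideal.mul_mem_left _ (w (k + 1))
      (head_mem_paramIdeal (c := k + 1) (n := n) (N := N) (w := w) (y₀ := y₀) (ys := ys))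
    have h2 := D.mul_pow_mem' (N := N) hsn (Nat.lt_succ_self k) hN
    convert Ideal.sub_mem _ h1 h2 using 1
    ring
  | of_succ i hi ih =>
    rw [show c + 1 - i = c + 1 - (i + 1) + 1 by omega, pow_succ', pow_mul]
    have h := chain_mem_paramIdeal (n := n) (N := N) (w := w) (y₀ := y₀) (ys := ys) hi
    have h2 := Ideal.Quotient.eq_zero_iff_mem.mpr h
    rw [← Ideal.Quotient.eq_zero_iff_mem] at ih ⊢
    rw [map_add, map_mul, add_comm, add_eq_zero_iff_eq_neg] at h2
    rw [map_pow, h2, neg_pow, mul_pow, ← map_pow (Ideal.Quotient.mk _) (w (i + 1)), ih]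
    simp

lemma chain_pow_mem' (hsn : s ≤ n) (hN : c * n + s ≤ N) {i : ℕ} (hi : i ≤ c) :
    w i ^ ((n + 1) ^ (c + 1)) ∈ paramIdeal c n N w y₀ ys :=
  pow_mem_of_pow_mem_of_le (D.chain_pow_mem hsn hN hi)
    (Nat.pow_le_pow_right (Nat.succ_pos n) (Nat.sub_le _ _))

lemma extra_pow_mem (hsn : s ≤ n) (hN : c * n + s ≤ N) :
    q ^ ((s + 1) * (2 * (n + 1) ^ (c + 1))) ∈ paramIdeal c n N w y₀ ys := by
  rw [pow_mul]
  obtain ⟨a, ha, b, hb, hab⟩ := Submodule.mem_sup.mp D.pow_mem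
  obtain ⟨a, rfl⟩ := Ideal.mem_span_singleton'.mp ha
  obtain ⟨b, rfl⟩ := Ideal.mem_span_singleton'.mp hb
  rw [← hab]
  -- Twice the common nilpotency exponent of `w 0` and `w 1` suffices for a combination of the two.
  refine Ideal.add_pow_mem_of_pow_mem_of_le _ (m := (n + 1) ^ (c + 1)) (n := (n + 1) ^ (c + 1))
    ?_ ?_ (by rw [two_mul]; exact Nat.le_succ _)
  · rw [mul_pow]
    exact Ideal.mul_mem_left _ _ (D.chain_pow_mem' hsn hN (Nat.zero_le c))
  · rw [mul_pow]
    exact Ideal.mul_mem_left _ _ (D.chain_pow_mem' hsn hN D.one_le)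

lemma maximalIdeal_le_iff {J : Ideal R} : IsLocalRing.maximalIdeal R ≤ J ↔
    (∀ i < c, w (i + 1) ∈ J) ∧ (∀ a ∈ ys, a ∈ J) ∧ y₀ ∈ J ∧ q ∈ J := by
  rw [← D.maximalIdeal_eq, sup_le_iff, sup_le_iff, sup_le_iff, Ideal.span_singleton_le_iff_mem,
    Ideal.span_singleton_le_iff_mem, Ideal.ofList, Ideal.ofList, Ideal.span_le, Ideal.span_le,
    and_assoc, and_assoc]
  refine and_congr ⟨fun h i hi => h (List.mem_map.mpr ⟨i, List.mem_range.mpr hi, rfl⟩), ?_⟩ Iff.rfl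
  rintro h _ hr
  obtain ⟨i, hi, rfl⟩ := List.mem_map.mp hr
  exact h i (List.mem_range.mp hi)

lemma mem_maximalIdeal : (∀ i < c, w (i + 1) ∈ IsLocalRing.maximalIdeal R) ∧
    (∀ a ∈ ys, a ∈ IsLocalRing.maximalIdeal R) ∧ y₀ ∈ IsLocalRing.maximalIdeal R ∧
    q ∈ IsLocalRing.maximalIdeal R :=
  D.maximalIdeal_le_iff.mp le_rfl

lemma chain_mem_maximalIdeal {i : ℕ} (hi : i ≤ c) : w i ∈ IsLocalRing.maximalIdeal R := by
  cases i with
  | zero => exact D.zero_mem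
  | succ i => exact D.mem_maximalIdeal.1 i hi

lemma maximalIdeal_le_radical (hsn : s ≤ n) (hn : 1 ≤ n) (hN : c * n + s ≤ N) :
    IsLocalRing.maximalIdeal R ≤ (paramIdeal c n N w y₀ ys).radical := by
  refine D.maximalIdeal_le_iff.mpr ⟨fun i hi => ⟨_, D.chain_pow_mem' hsn hN hi⟩,
    fun a ha => ⟨N, pow_mem_paramIdeal ha⟩, ?_, ⟨_, D.extra_pow_mem hsn hN⟩⟩
  have h1 : w c ∈ (paramIdeal c n N w y₀ ys).radical := ⟨_, D.chain_pow_mem' hsn hN le_rfl⟩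
  have h2 : y₀ ^ N ∈ (paramIdeal c n N w y₀ ys).radical := by
    rw [← Ideal.add_mem_iff_left _ (Ideal.pow_mem_of_mem _ h1 n hn)]
    exact Ideal.le_radical head_mem_paramIdeal
  exact Ideal.mem_radical_of_pow_mem h2

lemma paramIdeal_le (hN : n ≤ N) :
    paramIdeal c n N w y₀ ys ≤ IsLocalRing.maximalIdeal R ^ n := by
  rw [paramIdeal, Ideal.ofList, Ideal.span_le]
  intro r hr
  rw [Set.mem_ofPred_eq, paramGens, List.mem_append, List.mem_cons] at hr
  have hy := D.mem_maximalIdeal.2.2.1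
  rcases hr with hr | rfl | hr
  · obtain ⟨i, hi, rfl⟩ := List.mem_map.mp hr
    rw [List.mem_range] at hi
    exact Ideal.add_mem _ (Ideal.mul_mem_left _ _ (Ideal.pow_mem_pow hy n))
      (Ideal.pow_le_pow_right (Nat.le_succ n)
        (Ideal.pow_mem_pow (D.chain_mem_maximalIdeal hi.le) _))
  · exact Ideal.add_mem _ (Ideal.pow_le_pow_right hN (Ideal.pow_mem_pow hy N))
      (Ideal.pow_mem_pow (D.chain_mem_maximalIdeal le_rfl) _)
  · obtain ⟨a, ha, rfl⟩ := List.mem_map.mp hr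
    exact Ideal.pow_le_pow_right hN (Ideal.pow_mem_pow (D.mem_maximalIdeal.2.1 a ha) N)

omit D in
lemma quotLength_maximalIdeal : quotLength (IsLocalRing.maximalIdeal R) = 1 := by
  rw [quotLength, Module.length_eq_one_iff, isSimpleModule_iff_isCoatom]
  exact Ideal.isMaximal_def.mp inferInstance

/-- The elements generate the maximal ideal, whose quotient has length one, so the quotient by their
powers has length at most the product of the exponents. -/
lemma quotLength_box_le (E a b N : ℕ) :
    quotLength (Ideal.ofList (((List.range c).map fun i => w (i + 1)).map (· ^ E)) ⊔
      Ideal.ofList (ys.map (· ^ N)) ⊔ Ideal.span {y₀ ^ a} ⊔ Ideal.span {q ^ b}) ≤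
      ((b * (a * (N ^ ys.length * E ^ c)) : ℕ) : ℕ∞) := by
  set W := (List.range c).map fun i => w (i + 1) with hW
  have hWl : W.length = c := by simp [hW]
  push_cast
  refine (length_quotient_sup_pow_le _ q b).trans ?_
  gcongr
  rw [sup_right_comm]
  refine (length_quotient_sup_pow_le _ y₀ a).trans ?_
  gcongr
  have e1 : Ideal.ofList (W.map (· ^ E)) ⊔ Ideal.ofList (ys.map (· ^ N)) ⊔ Ideal.span {q} ⊔
      Ideal.span {y₀} = Ideal.ofList (W.map (· ^ E)) ⊔ Ideal.span {q} ⊔ Ideal.span {y₀} ⊔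
      Ideal.ofList (ys.map (· ^ N)) := by ac_rfl
  rw [e1]
  refine (length_quotient_sup_ofList_pow_le N ys _).trans ?_
  gcongr
  have e2 : Ideal.ofList (W.map (· ^ E)) ⊔ Ideal.span {q} ⊔ Ideal.span {y₀} ⊔
      Ideal.ofList ys = Ideal.span {q} ⊔ Ideal.span {y₀} ⊔ Ideal.ofList ys ⊔
      Ideal.ofList (W.map (· ^ E)) := by ac_rfl
  rw [e2]
  refine (length_quotient_sup_ofList_pow_le E W _).trans ?_
  rw [hWl]
  conv_rhs => rw [← mul_one ((E : ℕ∞) ^ c)]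
  gcongr
  have e3 : Ideal.span {q} ⊔ Ideal.span {y₀} ⊔ Ideal.ofList ys ⊔ Ideal.ofList W =
      IsLocalRing.maximalIdeal R := by
    rw [← D.maximalIdeal_eq]; ac_rfl
  rw [e3, quotLength_maximalIdeal]

/-- This is the main term. Subadditivity for the product `q ^ (s + 1) * y₀ ^ s` gives one piece with
small exponent on `q`, of order `N ^ h`, and one with small exponent on `y₀`, of order `N ^ (h -
1)`. -/
lemma quotLength_paramIdeal_sup_le (hsn : s ≤ n) (hn : 1 ≤ n) (hN : c * n + s ≤ N) :
    quotLength (paramIdeal c n N w y₀ ys ⊔ Ideal.ofList ((List.range c).map fun i => w (i + 1))) ≤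
      (((s + 1) * (N * N ^ ys.length) +
        (s + 1) * (2 * (n + 1) ^ (c + 1)) * (s * N ^ ys.length) : ℕ) : ℕ∞) := by
  set W := (List.range c).map fun i => w (i + 1) with hW
  set E' := (s + 1) * (2 * (n + 1) ^ (c + 1)) with hE'
  have hW1 : W.map (· ^ 1) = W := by simp
  set T := Ideal.ofList (W.map (· ^ 1)) ⊔ Ideal.ofList (ys.map (· ^ N)) ⊔
    Ideal.span {y₀ ^ N} ⊔ Ideal.span {q ^ E'} with hT
  have hwmem : ∀ i < c, w (i + 1) ∈ Ideal.ofList W := fun i hi =>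
    mem_ofList_of_mem (List.mem_map.mpr ⟨i, List.mem_range.mpr hi, rfl⟩)
  obtain ⟨c', hc'⟩ := Nat.exists_eq_add_of_le' D.one_le
  have hTle : T ⊔ Ideal.span {q ^ (s + 1) * y₀ ^ s} ≤
      paramIdeal c n N w y₀ ys ⊔ Ideal.ofList W := by
    refine sup_le (sup_le (sup_le (sup_le ?_ ?_) ?_) ?_) ?_
    · rw [hW1]; exact le_sup_right
    · exact map_pow_ofList_le fun a ha => Ideal.mem_sup_left (pow_mem_paramIdeal ha)
    · rw [Ideal.span_singleton_le_iff_mem]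
      have h1 : w c ^ n ∈ paramIdeal c n N w y₀ ys ⊔ Ideal.ofList W := by
        refine Ideal.pow_mem_of_mem _ (Ideal.mem_sup_right ?_) n hn
        rw [hc']
        exact hwmem c' (by omega)
      rw [← Ideal.add_mem_iff_left _ h1]
      exact Ideal.mem_sup_left head_mem_paramIdeal
    · rw [Ideal.span_singleton_le_iff_mem]
      exact Ideal.mem_sup_left (D.extra_pow_mem hsn hN)
    · rw [Ideal.span_singleton_le_iff_mem]
      refine Ideal.mem_sup_right ?_
      refine (Ideal.span_singleton_le_iff_mem (I := Ideal.ofList W)).mpr ?_ D.pow_mul_pow_mem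
      exact hwmem 0 (by omega)
  refine (length_quotient_anti hTle).trans ((length_quotient_sup_mul_le _ _ _).trans ?_)
  rw [Nat.cast_add]
  refine add_le_add ?_ ?_
  · refine (length_quotient_anti ?_).trans ((D.quotLength_box_le 1 N (s + 1) N).trans_eq ?_)
    · exact sup_le_sup_right le_sup_left _
    · simp
  · refine (length_quotient_anti ?_).trans ((D.quotLength_box_le 1 s E' N).trans_eq ?_)
    · refine sup_le (sup_le (le_sup_left.trans (le_sup_left.trans le_sup_left)) le_sup_right) ?_
      exact le_sup_right.trans le_sup_left
    · simp

/-- These are the error terms from adjoining `w 1, …, w k` one by one. Each image of multiplication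
by a `w` is killed by a box in which only the exponents of `ys` grow with `N`. -/
lemma quotLength_paramIdeal_le_add (hsn : s ≤ n) (hN : c * n + s ≤ N) {k : ℕ} (hk : k ≤ c) :
    quotLength (paramIdeal c n N w y₀ ys) ≤
      ((k * ((s + 1) * (2 * (n + 1) ^ (c + 1)) *
        ((c * n + s) * (N ^ ys.length * ((n + 1) ^ (c + 1)) ^ c))) : ℕ) : ℕ∞) +
      quotLength (paramIdeal c n N w y₀ ys ⊔
        Ideal.ofList ((List.range k).map fun i => w (i + 1))) := by
  induction k with
  | zero => simp
  | succ k ih =>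
    refine (ih (by omega)).trans ?_
    rw [Nat.succ_mul k, Nat.cast_add, add_assoc]
    gcongr
    rw [List.range_succ, List.map_append, Ideal.ofList_append, ← sup_assoc, List.map_singleton,
      Ideal.ofList_singleton]
    refine (length_quotient_le (w (k + 1)) ?_).trans
      (add_le_add_left (D.quotLength_box_le ((n + 1) ^ (c + 1)) (c * n + s)
        ((s + 1) * (2 * (n + 1) ^ (c + 1))) N) _)
    intro r hr
    refine Ideal.mem_sup_left ?_
    change r ∈ Submodule.comap (LinearMap.lsmul R R (w (k + 1))) (paramIdeal c n N w y₀ ys)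
    revert r
    rw [← SetLike.le_def]
    refine sup_le (sup_le (sup_le ?_ ?_) ?_) ?_
    · refine map_pow_ofList_le fun a ha => ?_
      obtain ⟨i, hi, rfl⟩ := List.mem_map.mp ha
      exact Ideal.mul_mem_left _ _ (D.chain_pow_mem' hsn hN (List.mem_range.mp hi))
    · exact map_pow_ofList_le fun a ha => Ideal.mul_mem_left _ _ (pow_mem_paramIdeal ha)
    · rw [Ideal.span_singleton_le_iff_mem]
      exact D.mul_pow_mem' hsn hk le_rfl
    · rw [Ideal.span_singleton_le_iff_mem]
      exact Ideal.mul_mem_left _ _ (D.extra_pow_mem hsn hN)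

/-- For fixed `n` and large `N` the length of `R / I` is at most `(s + 2) N ^ h`. -/
lemma exists_quotLength_paramIdeal_le (hsn : s ≤ n) (hn : 1 ≤ n) : ∃ N, 2 ≤ N ∧ n ≤ N ∧
    c * n + s ≤ N ∧ quotLength (paramIdeal c n N w y₀ ys) ≤
      (((s + 2) * (N * N ^ ys.length) : ℕ) : ℕ∞) := by
  set E' := (s + 1) * (2 * (n + 1) ^ (c + 1)) with hE'
  -- `C` collects all coefficients of `N ^ ys.length`; it depends only on `n` and fixed data, so `C
  -- ≤ N` absorbs the error into one more copy of the main term.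
  set C := c * (E' * ((c * n + s) * (((n + 1) ^ (c + 1)) ^ c))) + E' * s with hC
  refine ⟨C + (c * n + s) + n + 2, by omega, by omega, by omega, ?_⟩
  set N := C + (c * n + s) + n + 2 with hN
  have hN' : c * n + s ≤ N := by omega
  refine (D.quotLength_paramIdeal_le_add hsn hN' le_rfl).trans ?_
  refine (add_le_add_right (D.quotLength_paramIdeal_sup_le hsn hn hN') _).trans ?_
  rw [← Nat.cast_add, Nat.cast_le]
  have h1 : C * N ^ ys.length ≤ N * N ^ ys.length := Nat.mul_le_mul_right _ (by omega)
  calc _ = C * N ^ ys.length + (s + 1) * (N * N ^ ys.length) := by rw [hC]; ring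
    _ ≤ N * N ^ ys.length + (s + 1) * (N * N ^ ys.length) := by gcongr
    _ = _ := by ring

end ParameterData

end Parameters

/-! ### The lower bound for Koszul cohomology. -/

section LowerBound

variable {R : Type*} [CommRing R]

lemma pow_mul_mem_sup_pow {X : Ideal R} {q r : R} (a : ℕ) (hr : r ∈ X ⊔ Ideal.span {q}) :
    q ^ a * r ∈ X ⊔ Ideal.span {q ^ (a + 1)} := by
  obtain ⟨t, ht⟩ := mem_sup_span_singleton_iff.mp hr
  refine mem_sup_span_singleton_iff.mpr ⟨t, ?_⟩
  convert X.mul_mem_left (q ^ a) ht using 1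
  ring

/-- The lower bound for the Koszul cohomology of `R / M` in degree `h = #ys + 1`: the module
`R / M` sits between `R / (X + q)` and `R / (X + q^{t+1})`. -/
lemma quotLength_le_length_koszulCohomology {d : ℕ} {x : Fin d → R} {X M : Ideal R} {q y₀ g : R}
    {ys : List R} {t N : ℕ}
    (hXM : X ≤ M) (hM : M ≤ X ⊔ Ideal.span {q ^ (t + 1)}) (hqM : q ^ (t + 1) * y₀ ∈ M)
    (hreg₁ : SeqReg (X ⊔ Ideal.span {q}) (y₀ :: ys))
    (hreg₂ : SeqReg (X ⊔ Ideal.span {q ^ t}) (y₀ :: ys))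
    (hcolon : ∀ r, q ^ t * r ∈ X ⊔ Ideal.span {q ^ (t + 1)} → r ∈ X ⊔ Ideal.span {q})
    (hrad : ∀ a ∈ y₀ :: ys, a ∈ (Ideal.span (Set.range x)).radical)
    (hg : y₀ ^ (N + 1) - g ∈ X ⊔ Ideal.span {q})
    (hgx : ∀ a ∈ g :: ys.map (· ^ (N + 1)), a ∈ Ideal.span (Set.range x))
    (hx : ∀ j, x j ∈ X ⊔ Ideal.span {q} ⊔ Ideal.ofList (g :: ys.map (· ^ (N + 1)))) :
    quotLength (X ⊔ Ideal.span {q} ⊔ Ideal.ofList (ys.map (· ^ (N + 1))) ⊔ Ideal.span {y₀ ^ N}) ≤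
      Module.length R (KoszulCohomology x (R ⧸ M) (ys.length + 1)) := by
  set P := X ⊔ Ideal.span {q} with hP
  set Q := X ⊔ Ideal.span {q ^ (t + 1)} with hQ
  set Y := Ideal.ofList (ys.map (· ^ (N + 1))) with hY
  have hPg : P ⊔ Ideal.span {g} = P ⊔ Ideal.span {y₀ ^ (N + 1)} := by
    apply le_antisymm <;> refine sup_le le_sup_left ?_ <;>
      rw [Ideal.span_singleton_le_iff_mem, mem_sup_span_singleton_iff]
    · exact ⟨1, by convert P.neg_mem hg using 1; ring⟩
    · exact ⟨1, by convert hg using 1; ring⟩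
  have hregpow : SeqReg P ((y₀ :: ys).map (· ^ (N + 1))) := hreg₁.map_pow _
  have hregg : SeqReg P (g :: ys.map (· ^ (N + 1))) := by
    refine ⟨fun r hr => hregpow.1 r ?_, by rw [hPg]; exact hregpow.2⟩
    have := P.add_mem hr (P.mul_mem_right r hg)
    convert this using 1
    ring
  have hlen : (g :: ys.map (· ^ (N + 1))).length = ys.length + 1 := by simp
  have hJl : P ⊔ Ideal.ofList (g :: ys.map (· ^ (N + 1))) =
      P ⊔ Y ⊔ Ideal.span {y₀ ^ (N + 1)} := by
    rw [Ideal.ofList_cons, ← sup_assoc, hPg, sup_right_comm]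
  have hγ₁ := hregg.exists_injective_koszulCohomology hgx
  rw [hlen, hJl] at hγ₁
  rw [hJl] at hx
  obtain ⟨γ₁, hγ₁⟩ := hγ₁
  obtain ⟨γ₀, hγ₀⟩ := exists_injective_koszulCohomology_zero (x := x)
    (B := R ⧸ (P ⊔ Y ⊔ Ideal.span {y₀ ^ (N + 1)})) (fun j b => by
      obtain ⟨r, rfl⟩ := Submodule.Quotient.mk_surjective _ b
      rw [← Submodule.Quotient.mk_smul, Submodule.Quotient.mk_eq_zero]
      exact Ideal.mul_mem_right _ _ (hx j))
  have hιmem : ∀ r ∈ P, q ^ t * r ∈ Q := fun r hr => pow_mul_mem_sup_pow t hr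
  let ι : (R ⧸ P) →ₗ[R] (R ⧸ Q) := quotientMul (q ^ t) hιmem
  have hQt : X ⊔ Ideal.span {q ^ t} = Q ⊔ Ideal.span {q ^ t} := by
    rw [hQ, sup_assoc]
    congr 1
    refine (sup_eq_right.mpr ?_).symm
    rw [Ideal.span_singleton_le_span_singleton]
    exact pow_dvd_pow q (Nat.le_succ t)
  -- The cokernel `R / (X + q ^ t)` of `ι` has a regular sequence of length `ys.length + 1`, so its
  -- cohomology vanishes one degree below.
  have hι : Function.Injective (koszulMap x ι (ys.length + 1)) := by
    refine koszulMap_injective (quotientMul_injective _ hιmem hcolon)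
      (quotientMul_exact _ hιmem hQt) (Submodule.factor_surjective _) ?_
    intro j hj
    exact hreg₂.koszulVanishes hrad j (by simp; omega)
  let φ : (R ⧸ P) →ₗ[R] (R ⧸ M) := quotientMul (q ^ t * y₀) fun r hr => by
    obtain ⟨a, ha⟩ := mem_sup_span_singleton_iff.mp hr
    have h1 := M.mul_mem_left (q ^ t * y₀) (hXM ha)
    have h2 := M.mul_mem_left a hqM
    convert M.add_mem h1 h2 using 1
    ring
  let ψ : (R ⧸ M) →ₗ[R] (R ⧸ Q) := Submodule.factor hM
  -- Multiplication by `q ^ t` itself need not map `R / P` to `R / M`; the extra factor `y₀` repairs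
  -- this. Hence the image of `ψ` on cohomology contains `y₀` times the image of `ι`.
  have hψφ : ψ ∘ₗ φ = y₀ • ι := by
    ext
    change (Submodule.Quotient.mk (q ^ t * y₀ * 1) : R ⧸ Q) =
      Submodule.Quotient.mk (y₀ * (q ^ t * 1))
    congr 1
    ring
  have hmulmem : ∀ r ∈ P ⊔ Y ⊔ Ideal.span {y₀ ^ N},
      y₀ * r ∈ P ⊔ Y ⊔ Ideal.span {y₀ ^ (N + 1)} := by
    intro r hr
    obtain ⟨a, ha⟩ := mem_sup_span_singleton_iff.mp hr
    refine mem_sup_span_singleton_iff.mpr ⟨a, ?_⟩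
    convert (P ⊔ Y).mul_mem_left y₀ ha using 1
    ring
  -- Multiplying by `y₀` loses only one power: the image of `y₀` in `R / (P + Y + y₀ ^ (N + 1))` is
  -- a copy of `R / (P + Y + y₀ ^ N)`.
  have hyreg : RegularMod (P ⊔ Y) y₀ :=
    hreg₁.1.sup_ofList (SeqReg.map_pow (N + 1) hreg₁.2)
  have hmulinj : Function.Injective (quotientMul y₀ hmulmem) := by
    refine quotientMul_injective y₀ hmulmem fun r hr => ?_
    obtain ⟨a, ha⟩ := mem_sup_span_singleton_iff.mp hr
    refine mem_sup_span_singleton_iff.mpr ⟨a, hyreg _ ?_⟩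
    convert ha using 1
    ring
  let η := koszulMap x ι (ys.length + 1) ∘ₗ γ₁ ∘ₗ γ₀
  have hη : Function.Injective η := hι.comp (hγ₁.comp hγ₀)
  have hrange : ∀ z, (η ∘ₗ quotientMul y₀ hmulmem) z ∈
      LinearMap.range (koszulMap x ψ (ys.length + 1)) := by
    intro z
    obtain ⟨r, rfl⟩ := Submodule.Quotient.mk_surjective _ z
    refine ⟨koszulMap x φ _ (γ₁ (γ₀ (Submodule.Quotient.mk r))), ?_⟩
    rw [← LinearMap.comp_apply, koszulMap_comp, hψφ, koszulMap_smul, LinearMap.comp_apply,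
      quotientMul_mk, ← smul_eq_mul, Submodule.Quotient.mk_smul, map_smul]
    rfl
  have h1 : Module.length R (R ⧸ (P ⊔ Y ⊔ Ideal.span {y₀ ^ N})) ≤
      Module.length R (LinearMap.range (koszulMap x ψ (ys.length + 1))) :=
    Module.length_le_of_injective (LinearMap.codRestrict _ _ hrange)
      ((LinearMap.injective_codRestrict_iff ..).mpr (hη.comp hmulinj))
  exact h1.trans (Module.length_le_of_surjective (LinearMap.rangeRestrict _)
    (LinearMap.surjective_rangeRestrict _))

lemma le_quotLength_of_seqReg {P : Ideal R} {y₀ : R} {ys : List R} (h : SeqReg P (y₀ :: ys))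
    (hP : P ⊔ Ideal.ofList (y₀ :: ys) ≠ ⊤) (N e : ℕ) :
    ((N * e ^ ys.length : ℕ) : ℕ∞) ≤
      quotLength (P ⊔ Ideal.ofList (ys.map (· ^ e)) ⊔ Ideal.span {y₀ ^ N}) := by
  have h0 : 1 ≤ quotLength (P ⊔ Ideal.span {y₀} ⊔ Ideal.ofList ys) := by
    rw [sup_assoc, ← Ideal.ofList_cons, quotLength, Order.one_le_iff_pos, Module.length_pos_iff]
    exact Ideal.Quotient.nontrivial_iff.mpr hP
  refine le_trans ?_ (length_quotient_sup_pow (h.1.sup_ofList (SeqReg.map_pow e h.2)) N)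
  rw [Nat.cast_mul]
  gcongr
  rw [sup_right_comm]
  refine le_trans ?_ (length_quotient_sup_ofList_pow e h.2)
  rw [Nat.cast_pow]
  conv_lhs => rw [← mul_one ((e : ℕ∞) ^ _)]
  gcongr

end LowerBound

/-! ### Two-sided bounds for the Krull dimension. -/

section Dimension

variable {R : Type*} [CommRing R]

lemma SeqReg.length_le_ringKrullDim {l : List R} : ∀ {J : Ideal R}, SeqReg J l →
    J ⊔ Ideal.ofList l ≠ ⊤ → (l.length : WithBot ℕ∞) ≤ ringKrullDim (R ⧸ J) := by
  induction l with
  | nil =>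
    intro J _ h
    have : Nontrivial (R ⧸ J) := Ideal.Quotient.nontrivial_iff.mpr (by simpa using h)
    simpa using ringKrullDim_nonneg_of_nontrivial
  | cons a l ih =>
    intro J h htop
    have h1 := ih h.2 (by rwa [sup_assoc, ← Ideal.ofList_cons])
    have ha : Ideal.Quotient.mk J a ∈ nonZeroDivisors (R ⧸ J) := by
      rw [mem_nonZeroDivisors_iff_right]
      intro b hb
      obtain ⟨b, rfl⟩ := Ideal.Quotient.mk_surjective b
      rw [← map_mul, Ideal.Quotient.eq_zero_iff_mem] at hb
      rw [Ideal.Quotient.eq_zero_iff_mem]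
      exact h.1 b (by rwa [mul_comm])
    have h2 := ringKrullDim_succ_le_of_surjective
      (Ideal.Quotient.factor (le_sup_left : J ≤ J ⊔ Ideal.span {a}))
      (Ideal.Quotient.factor_surjective _) ha (by
        rw [Ideal.Quotient.factor_mk, Ideal.Quotient.eq_zero_iff_mem]
        exact Ideal.mem_sup_right (Ideal.mem_span_singleton_self a))
    rw [List.length_cons, Nat.cast_succ]
    exact (add_le_add_left h1 1).trans h2

/-- By Krull's height theorem. Applied to the parameters themselves, it turns the lower bound on the
dimension into the equality required of a system of parameters. -/
lemma ringKrullDim_le_of_maximalIdeal_le_radical [IsLocalRing R] [IsNoetherianRing R] {l : List R}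
    (hl : Ideal.ofList l ≤ IsLocalRing.maximalIdeal R)
    (h : IsLocalRing.maximalIdeal R ≤ (Ideal.ofList l).radical) :
    ringKrullDim R ≤ l.length := by
  classical
  have hmem : IsLocalRing.maximalIdeal R ∈ (Ideal.span (l.toFinset : Set R)).minimalPrimes := by
    have : Ideal.span (l.toFinset : Set R) = Ideal.ofList l := by
      rw [Ideal.ofList, List.coe_toFinset]
    rw [this]
    refine ⟨⟨inferInstance, hl⟩, fun J hJ _ => ?_⟩
    exact h.trans (hJ.1.radical_le_iff.mpr hJ.2)
  have h1 := Ideal.height_le_card_of_mem_minimalPrimes_span_finset hmem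
  rw [← IsLocalRing.maximalIdeal_height_eq_ringKrullDim]
  exact_mod_cast h1.trans (by exact_mod_cast l.toFinset_card_le)

end Dimension

/-! ### From the length bounds to noneffaceability. -/

section Effaceable

variable {R : Type*} [CommRing R] [IsLocalRing R] [IsNoetherianRing R]

/-- A criterion for a module not to be effaceable. -/
lemma not_isEffaceable_of_le {c s : ℕ} {w : ℕ → R} {y₀ q : R} {ys : List R}
    (D : ParameterData R c s w y₀ q ys) 
    (hdim : ((c + (ys.length + 1) : ℕ) : WithBot ℕ∞) ≤ ringKrullDim R)
    (L : Type*) [AddCommGroup L] [Module R L] (i : ℕ)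
    (H : ∀ n N (x : Fin (c + (ys.length + 1)) → R), s ≤ n → 1 ≤ n → c * n + s ≤ N + 1 →
      Ideal.span (Set.range x) = paramIdeal c n (N + 1) w y₀ ys →
      (∀ j, x j ∈ paramGens c n (N + 1) w y₀ ys) →
      ((N * (N + 1) ^ ys.length : ℕ) : ℕ∞) ≤ Module.length R (KoszulCohomology x L i)) :
    ¬ IsEffaceable R L i := by
  intro hE
  -- The `k`-th ideal uses `n = k + 1 + s`, which guarantees `1 ≤ n`, `s ≤ n` and containment in the
  -- `k`-th power of the maximal ideal.
  have hex : ∀ k : ℕ, ∃ N, 2 ≤ N ∧ k + 1 + s ≤ N ∧ c * (k + 1 + s) + s ≤ N ∧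
      quotLength (paramIdeal c (k + 1 + s) N w y₀ ys) ≤
        (((s + 2) * (N * N ^ ys.length) : ℕ) : ℕ∞) :=
    fun k => D.exists_quotLength_paramIdeal_le (by omega) (by omega)
  choose N hN2 hNn hNc hNlen using hex
  have hgl : ∀ n N, (paramGens c n N w y₀ ys).length = c + (ys.length + 1) := by
    intro n N; simp [paramGens]
  let x : ℕ → Fin (c + (ys.length + 1)) → R := fun k j =>
    (paramGens c (k + 1 + s) (N k) w y₀ ys).get (j.cast (hgl _ _).symm)
  have hxr : ∀ k, Ideal.span (Set.range (x k)) = paramIdeal c (k + 1 + s) (N k) w y₀ ys := by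
    intro k
    rw [paramIdeal, Ideal.ofList]
    congr 1
    ext r
    rw [Set.mem_range, Set.mem_ofPred_eq, List.mem_iff_get]
    constructor
    · rintro ⟨j, rfl⟩; exact ⟨_, rfl⟩
    · rintro ⟨j, rfl⟩; exact ⟨j.cast (hgl _ _), rfl⟩
  have hle : ∀ k, paramIdeal c (k + 1 + s) (N k) w y₀ ys ≤
      IsLocalRing.maximalIdeal R ^ (k + 1 + s) := fun k => D.paramIdeal_le (hNn k)
  have hle1 : ∀ k, paramIdeal c (k + 1 + s) (N k) w y₀ ys ≤ IsLocalRing.maximalIdeal R :=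
    fun k => (hle k).trans (Ideal.pow_le_self (by omega))
  have hrad : ∀ k, IsLocalRing.maximalIdeal R ≤
      (paramIdeal c (k + 1 + s) (N k) w y₀ ys).radical :=
    fun k => D.maximalIdeal_le_radical (by omega) (by omega) (hNc k)
  have hdim' : ringKrullDim R = ((c + (ys.length + 1) : ℕ) : WithBot ℕ∞) := by
    refine le_antisymm ?_ hdim
    have := ringKrullDim_le_of_maximalIdeal_le_radical (hle1 0) (hrad 0)
    rwa [hgl] at this
  have ht := hE _ x (fun k => ⟨hdim', by
      rw [hxr]
      refine le_antisymm ?_ (hrad k)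
      exact (IsLocalRing.maximalIdeal.isMaximal R).isPrime.radical_le_iff.mpr (hle1 k)⟩)
    (fun k => by
      rw [hxr]
      exact (hle k).trans (Ideal.pow_le_pow_right (by omega)))
  -- The factor `s + 2` is the colength bound, and `2` compares `N` with `N - 1` for `N ≥ 2`. A
  -- single index with a smaller ratio already gives a contradiction.
  have hpos : (0 : ℝ≥0∞) < ((2 * (s + 2) : ℕ) : ℝ≥0∞)⁻¹ :=
    ENNReal.inv_pos.mpr (ENNReal.natCast_ne_top _)
  obtain ⟨k, hk⟩ := (ht.eventually (gt_mem_nhds hpos)).exists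
  refine absurd hk (not_lt.mpr ?_)
  obtain ⟨N', hN'⟩ : ∃ N', N k = N' + 1 := ⟨N k - 1, by have := hN2 k; omega⟩
  have hlow := H (k + 1 + s) N' (x k) (by omega) (by omega)
    (by have := hNc k; omega) (by rw [hxr, hN']) (fun j => by rw [← hN']; exact List.get_mem _ _)
  have hup : Module.length R (R ⧸ Ideal.span (Set.range (x k))) ≤
      ((2 * (s + 2) : ℕ) : ℕ∞) * Module.length R (KoszulCohomology (x k) L i) := by
    have h1 := hNlen k
    rw [← hxr] at h1
    refine h1.trans (le_trans ?_ (mul_le_mul_right hlow _))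
    have h2 : N k ≤ 2 * N' := by have := hN2 k; omega
    rw [← Nat.cast_mul, Nat.cast_le, hN']
    rw [hN'] at h2
    calc (s + 2) * ((N' + 1) * (N' + 1) ^ ys.length)
        ≤ (s + 2) * (2 * N' * (N' + 1) ^ ys.length) := by gcongr
      _ = _ := by ring
  have hup' : (Module.length R (R ⧸ Ideal.span (Set.range (x k))) : ℝ≥0∞) ≤
      ((2 * (s + 2) : ℕ) : ℝ≥0∞) *
        (Module.length R (KoszulCohomology (x k) L i) : ℝ≥0∞) := by
    have := ENat.toENNReal_le.mpr hup
    rwa [ENat.toENNReal_mul, ENat.toENNReal_coe] at this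
  have hne : Module.length R (R ⧸ Ideal.span (Set.range (x k))) ≠ ⊤ := by
    have h1 := hNlen k
    rw [← hxr] at h1
    exact ne_top_of_le_ne_top (ENat.natCast_ne_top _) h1
  have hne0 : Module.length R (R ⧸ Ideal.span (Set.range (x k))) ≠ 0 := by
    rw [← pos_iff_ne_zero, Module.length_pos_iff]
    refine Ideal.Quotient.nontrivial_iff.mpr ?_
    rw [hxr]
    exact ne_top_of_le_ne_top (Ideal.IsPrime.ne_top inferInstance) (hle1 k)
  rw [ENNReal.le_div_iff_mul_le (Or.inl (by simpa using hne0)) (Or.inl (by simpa using hne)),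
    ENNReal.inv_mul_le_iff (by simp) (ENNReal.natCast_ne_top _)]
  exact hup'

/-- Ideals trapped between `X + q' ^ (t + 1)` and `X`, up to multiplication by `y₀`, give
noneffaceable modules. -/
theorem ParameterData.not_isEffaceable {c s t : ℕ} {w : ℕ → R} {y₀ q q' : R} {ys : List R}
    (D : ParameterData R c s w y₀ q ys)
    (hdim : ((c + (ys.length + 1) : ℕ) : WithBot ℕ∞) ≤ ringKrullDim R) {X M : Ideal R}
    (hXM : X ≤ M) (hM : M ≤ X ⊔ Ideal.span {q' ^ (t + 1)}) (hqM : q' ^ (t + 1) * y₀ ∈ M)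
    (hw : ∀ i ≤ c, w i ∈ X ⊔ Ideal.span {q'})
    (hP : X ⊔ Ideal.span {q'} ≤ IsLocalRing.maximalIdeal R)
    (hreg₁ : SeqReg (X ⊔ Ideal.span {q'}) (y₀ :: ys))
    (hreg₂ : SeqReg (X ⊔ Ideal.span {q' ^ t}) (y₀ :: ys))
    (hcolon : ∀ r, q' ^ t * r ∈ X ⊔ Ideal.span {q' ^ (t + 1)} → r ∈ X ⊔ Ideal.span {q'}) :
    ((∃ l : List R, SeqReg ⊥ l ∧ ys.length + 1 < l.length ∧
      ∀ a ∈ l, a ∈ IsLocalRing.maximalIdeal R) → ¬ IsEffaceable R M (ys.length + 1 + 1)) ∧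
    ¬ IsEffaceable R (R ⧸ M) (ys.length + 1) := by
  have hPy : X ⊔ Ideal.span {q'} ⊔ Ideal.ofList (y₀ :: ys) ≠ ⊤ := by
    refine ne_top_of_le_ne_top (Ideal.IsPrime.ne_top inferInstance :
      IsLocalRing.maximalIdeal R ≠ ⊤) (sup_le hP ?_)
    rw [Ideal.ofList, Ideal.span_le]
    intro a ha
    rcases List.mem_cons.mp ha with rfl | ha
    · exact D.mem_maximalIdeal.2.2.1
    · exact D.mem_maximalIdeal.2.1 a ha
  have key : ∀ n N (x : Fin (c + (ys.length + 1)) → R), s ≤ n → 1 ≤ n → c * n + s ≤ N + 1 →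
      Ideal.span (Set.range x) = paramIdeal c n (N + 1) w y₀ ys →
      (∀ j, x j ∈ paramGens c n (N + 1) w y₀ ys) →
      ((N * (N + 1) ^ ys.length : ℕ) : ℕ∞) ≤
        Module.length R (KoszulCohomology x (R ⧸ M) (ys.length + 1)) := by
    intro n N x hsn hn hN hx hxj
    have hwc : w c ^ n ∈ X ⊔ Ideal.span {q'} := Ideal.pow_mem_of_mem _ (hw c le_rfl) n hn
    refine (le_quotLength_of_seqReg hreg₁ hPy N (N + 1)).trans
      (quotLength_le_length_koszulCohomology (g := y₀ ^ (N + 1) + w c ^ n) hXM hM hqM hreg₁ hreg₂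
        hcolon ?_ ?_ ?_ ?_)
    · rw [hx]
      intro a ha
      apply D.maximalIdeal_le_radical hsn hn hN
      rcases List.mem_cons.mp ha with rfl | ha
      · exact D.mem_maximalIdeal.2.2.1
      · exact D.mem_maximalIdeal.2.1 a ha
    · convert (X ⊔ Ideal.span {q'}).neg_mem hwc using 1
      ring
    · rw [hx]
      intro a ha
      exact mem_ofList_of_mem (List.mem_append_right _ ha)
    · intro j
      rcases List.mem_append.mp (hxj j) with h | h
      · obtain ⟨i, hi, hij⟩ := List.mem_map.mp h
        rw [List.mem_range] at hi
        rw [← hij]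
        exact Ideal.mem_sup_left (Ideal.add_mem _ (Ideal.mul_mem_right _ _ (hw _ hi))
          (Ideal.pow_mem_of_mem _ (hw i hi.le) _ (Nat.succ_pos n)))
      · exact Ideal.mem_sup_right (mem_ofList_of_mem h)
  refine ⟨?_, not_isEffaceable_of_le D hdim _ _ key⟩
  rintro ⟨l, hl, hlen, hlm⟩
  refine not_isEffaceable_of_le D hdim _ _ fun n N x h1 h2 hN hx hxj => ?_
  refine (key n N x h1 h2 hN hx hxj).trans ?_
  -- The long regular sequence kills the cohomology of `R` in degree `ys.length + 1`, so that of `R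
  -- / M` embeds into that of `M` one degree higher.
  obtain ⟨γ, hγ⟩ := exists_koszulConnecting_injective (x := x) (i := ys.length + 1)
    (Submodule.subtype_injective M) (LinearMap.exact_subtype_mkQ M) (Submodule.mkQ_surjective M)
    (hl.koszulVanishes_self (fun a ha => by
      rw [hx]; exact D.maximalIdeal_le_radical h1 h2 hN (hlm a ha)) hlen)
  exact Module.length_le_of_injective γ hγ

end Effaceable

/-! ### Concatenation of regular sequences. -/

section SeqRegAppend

variable {R : Type*} [CommRing R]

lemma SeqReg.append {l₁ l₂ : List R} : ∀ {J : Ideal R}, SeqReg J l₁ →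
    SeqReg (J ⊔ Ideal.ofList l₁) l₂ → SeqReg J (l₁ ++ l₂) := by
  induction l₁ with
  | nil => intro J _ h; simpa using h
  | cons a l ih =>
    intro J h h'
    exact ⟨h.1, ih h.2 (by rwa [sup_assoc, ← Ideal.ofList_cons])⟩

end SeqRegAppend

/-! ### Regular sequences of variables and constants in power series rings. -/

section PowerSeries

open MvPowerSeries

variable {A : Type*} [CommRing A] {σ : Type*}

/-- Modulo the listed variables only monomials free of them matter, and their coefficients are
compared with `b`. Taking `b = 0` covers ideals of variables alone; regularity and the description
of the maximal ideal are read off from this criterion. -/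
lemma mem_span_C_sup_ofList_X (b : A) (l : List σ) : ∀ f : MvPowerSeries σ A,
    f ∈ Ideal.span {C b} ⊔ Ideal.ofList (l.map X) ↔
      ∀ m : σ →₀ ℕ, (∀ j ∈ l, m j = 0) → b ∣ coeff m f := by
  classical
  induction l with
  | nil =>
    intro f
    rw [List.map_nil, Ideal.ofList_nil, sup_bot_eq, Ideal.mem_span_singleton']
    constructor
    · rintro ⟨g, rfl⟩ m _
      rw [coeff_mul_C]
      exact dvd_mul_left _ _
    · intro h
      choose g hg using fun m => h m (by simp)
      let g' : MvPowerSeries σ A := g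
      have hg' : ∀ m, coeff m g' = g m := fun m => rfl
      exact ⟨g', ext fun m => by rw [coeff_mul_C, hg', hg m, mul_comm]⟩
  | cons j l ih =>
    intro f
    rw [List.map_cons, Ideal.ofList_cons, sup_comm (Ideal.span {X j}), ← sup_assoc,
      mem_sup_span_singleton_iff]
    constructor
    · rintro ⟨t, ht⟩ m hm
      have h1 := (ih _).mp ht m (fun i hi => hm i (List.mem_cons_of_mem _ hi))
      rwa [map_sub, X_dvd_iff.mp (dvd_mul_right (X j) t) m (hm j (by simp)), sub_zero] at h1
    · intro h
      let f₀ : MvPowerSeries σ A := fun m => if m j = 0 then coeff m f else 0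
      have hf₀ : ∀ m, coeff m f₀ = if m j = 0 then coeff m f else 0 := fun m => rfl
      obtain ⟨t, ht⟩ : X j ∣ f - f₀ := X_dvd_iff.mpr fun m hm => by
        rw [map_sub, hf₀, if_pos hm, sub_self]
      refine ⟨t, ?_⟩
      rw [← ht, sub_sub_cancel, ih]
      intro m hm
      rw [hf₀]
      split_ifs with hmj
      · refine h m fun i hi => ?_
        rcases List.mem_cons.mp hi with rfl | hi
        · exact hmj
        · exact hm i hi
      · exact dvd_zero b

lemma regularMod_X (b : A) {l : List σ} {i : σ} (hi : i ∉ l) :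
    RegularMod (Ideal.span {C b} ⊔ Ideal.ofList (l.map X)) (X i : MvPowerSeries σ A) := by
  classical
  intro f hf
  rw [mem_span_C_sup_ofList_X] at hf ⊢
  intro m hm
  have h := hf (Finsupp.single i 1 + m) fun j hj => by
    have hne : i ≠ j := fun h => hi (h ▸ hj)
    simp [hm j hj, hne]
  rwa [X, coeff_add_monomial_mul, one_mul] at h

lemma seqReg_X (b : A) (l : List σ) : ∀ l₀ : List σ, l.Nodup → (∀ a ∈ l, a ∉ l₀) →
    SeqReg (Ideal.span {C b} ⊔ Ideal.ofList (l₀.map X))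
      (l.map (X : σ → MvPowerSeries σ A)) := by
  induction l with
  | nil => intros; trivial
  | cons a l ih =>
    intro l₀ hl hd
    rw [List.nodup_cons] at hl
    refine ⟨regularMod_X b (hd a (by simp)), ?_⟩
    have h := ih (a :: l₀) hl.2 fun c hc hc' => by
      rcases List.mem_cons.mp hc' with rfl | hc'
      · exact hl.1 hc
      · exact hd c (by simp [hc]) hc'
    rwa [List.map_cons, Ideal.ofList_cons, sup_comm (Ideal.span {X a}), ← sup_assoc] at h

lemma regularMod_C [IsDomain A] {p : A} (hp : p ≠ 0) (l : List σ) :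
    RegularMod (Ideal.ofList (l.map X)) (C p : MvPowerSeries σ A) := by
  have h0 : Ideal.ofList (l.map X) =
      Ideal.span {C (0 : A)} ⊔ Ideal.ofList (l.map (X : σ → MvPowerSeries σ A)) := by simp
  rw [h0]
  intro f hf
  rw [mem_span_C_sup_ofList_X] at hf ⊢
  intro m hm
  have h := hf m hm
  rw [coeff_C_mul, zero_dvd_iff] at h
  rw [zero_dvd_iff]
  exact (mul_eq_zero.mp h).resolve_left hp

lemma maximalIdeal_mvPowerSeries [IsLocalRing A] {p : A}
    (hp : IsLocalRing.maximalIdeal A = Ideal.span {p}) {l : List σ} (hl : ∀ i, i ∈ l) :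
    Ideal.span {C p} ⊔ Ideal.ofList (l.map X) =
      IsLocalRing.maximalIdeal (MvPowerSeries σ A) := by
  ext f
  rw [mem_span_C_sup_ofList_X, IsLocalRing.mem_maximalIdeal, mem_nonunits_iff,
    isUnit_iff_constantCoeff, ← mem_nonunits_iff, ← IsLocalRing.mem_maximalIdeal, hp,
    Ideal.mem_span_singleton]
  constructor
  · intro h
    simpa using h 0 (by simp)
  · intro h m hm
    obtain rfl : m = 0 := Finsupp.ext fun i => hm i (hl i)
    simpa using h

variable (A) in
/-- The variable `x_{i+1}` of `A[[x_1, …, x_e]]`, or `0` if `i ≥ e`. -/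
noncomputable def natVar (e i : ℕ) : MvPowerSeries (Fin e) A :=
  if h : i < e then X ⟨i, h⟩ else 0

lemma natVar_val {e : ℕ} (i : Fin e) : natVar A e i = X i := dif_pos i.2

lemma map_natVar_val {e : ℕ} (l : List (Fin e)) :
    (l.map Fin.val).map (natVar A e) = l.map X := by
  rw [List.map_map]
  exact List.map_congr_left fun i _ => natVar_val i

lemma exists_map_val_eq {e : ℕ} {l : List ℕ} (h : ∀ i ∈ l, i < e) :
    ∃ l' : List (Fin e), l'.map Fin.val = l :=
  ⟨l.pmap Fin.mk h, by rw [List.map_pmap]; simp⟩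

lemma seqReg_natVar {e : ℕ} (b : A) {l l₀ : List ℕ} (hl : ∀ i ∈ l, i < e) (hl₀ : ∀ i ∈ l₀, i < e)
    (hn : l.Nodup) (hd : ∀ a ∈ l, a ∉ l₀) :
    SeqReg (Ideal.span {C b} ⊔ Ideal.ofList (l₀.map (natVar A e))) (l.map (natVar A e)) := by
  obtain ⟨l, rfl⟩ := exists_map_val_eq hl
  obtain ⟨l₀, rfl⟩ := exists_map_val_eq hl₀
  rw [map_natVar_val, map_natVar_val]
  refine seqReg_X b l l₀ hn.of_map fun a ha ha' => ?_
  exact hd a (List.mem_map_of_mem ha) (List.mem_map_of_mem ha')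

lemma seqReg_natVar' {e : ℕ} {l l₀ : List ℕ} (hl : ∀ i ∈ l, i < e) (hl₀ : ∀ i ∈ l₀, i < e)
    (hn : l.Nodup) (hd : ∀ a ∈ l, a ∉ l₀) :
    SeqReg (Ideal.ofList (l₀.map (natVar A e))) (l.map (natVar A e)) := by
  simpa using seqReg_natVar (0 : A) hl hl₀ hn hd

lemma seqReg_C_cons_natVar [IsDomain A] {e : ℕ} {p : A} (hp : p ≠ 0) {l l₀ : List ℕ}
    (hl : ∀ i ∈ l, i < e) (hl₀ : ∀ i ∈ l₀, i < e) (hn : l.Nodup) (hd : ∀ a ∈ l, a ∉ l₀) :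
    SeqReg (Ideal.ofList (l₀.map (natVar A e))) (C p :: l.map (natVar A e)) := by
  refine ⟨?_, ?_⟩
  · obtain ⟨l₀, rfl⟩ := exists_map_val_eq hl₀
    rw [map_natVar_val]
    exact regularMod_C hp l₀
  · rw [sup_comm]
    exact seqReg_natVar p hl hl₀ hn hd

lemma maximalIdeal_natVar [IsLocalRing A] {p : A}
    (hp : IsLocalRing.maximalIdeal A = Ideal.span {p}) {e : ℕ} {l : List ℕ}
    (hl : ∀ i, i ∈ l ↔ i < e) :
    Ideal.span {C p} ⊔ Ideal.ofList (l.map (natVar A e)) =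
      IsLocalRing.maximalIdeal (MvPowerSeries (Fin e) A) := by
  obtain ⟨l, rfl⟩ := exists_map_val_eq fun i hi => (hl i).mp hi
  rw [map_natVar_val]
  refine maximalIdeal_mvPowerSeries hp fun i => ?_
  obtain ⟨j, hj, hij⟩ := List.mem_map.mp ((hl i).mpr i.2)
  rwa [← Fin.ext hij]

lemma idealOfVars_X_eq {e a b : ℕ} {l : List ℕ} (hl : ∀ i, i ∈ l ↔ i < e ∧ a ≤ i + 1 ∧ i + 1 ≤ b) :
    idealOfVars (X : Fin e → MvPowerSeries (Fin e) A) a b = Ideal.ofList (l.map (natVar A e)) := by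
  unfold idealOfVars Ideal.ofList
  congr 1
  ext r
  simp only [Set.mem_ofPred_eq, List.mem_map, hl]
  constructor
  · rintro ⟨j, h1, h2, rfl⟩
    exact ⟨j, ⟨j.2, h1, h2⟩, natVar_val j⟩
  · rintro ⟨i, ⟨h0, h1, h2⟩, rfl⟩
    exact ⟨⟨i, h0⟩, h1, h2, (natVar_val ⟨i, h0⟩).symm⟩

end PowerSeries

/-! ### The criterion when `R / M` itself carries the regular sequence. -/

section Effaceable

variable {R : Type*} [CommRing R] [IsLocalRing R]

lemma SeqReg.length_le_ringKrullDim_self {l : List R} {J : Ideal R} (h : SeqReg J l)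
    (hJ : J ⊔ Ideal.ofList l ≤ IsLocalRing.maximalIdeal R) :
    (l.length : WithBot ℕ∞) ≤ ringKrullDim R :=
  (h.length_le_ringKrullDim (ne_top_of_le_ne_top (Ideal.IsPrime.ne_top inferInstance) hJ)).trans
    (ringKrullDim_quotient_le J)

theorem ParameterData.not_isEffaceable_of_seqReg [IsNoetherianRing R] {c s : ℕ} {w : ℕ → R}
    {y₀ q : R} {ys : List R} (D : ParameterData R c s w y₀ q ys)
    (hdim : ((c + (ys.length + 1) : ℕ) : WithBot ℕ∞) ≤ ringKrullDim R) {M : Ideal R}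
    (hw : ∀ i ≤ c, w i ∈ M) (hM : M ≤ IsLocalRing.maximalIdeal R) (hreg : SeqReg M (y₀ :: ys)) :
    ((∃ l : List R, SeqReg ⊥ l ∧ ys.length + 1 < l.length ∧
      ∀ a ∈ l, a ∈ IsLocalRing.maximalIdeal R) → ¬ IsEffaceable R M (ys.length + 1 + 1)) ∧
    ¬ IsEffaceable R (R ⧸ M) (ys.length + 1) := by
  have h0 : M ⊔ Ideal.span {(0 : R)} = M := by simp
  -- With `q' = 0` and `t = 0` the sandwich collapses to `R / M`, and the cokernel of `ι` is the
  -- zero module.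
  refine D.not_isEffaceable hdim (X := M) (q' := 0) (t := 0) le_rfl le_sup_left (by simp) ?_ ?_ ?_
    ?_ ?_
  · rwa [h0]
  · rwa [h0]
  · rwa [h0]
  · rw [pow_zero, Ideal.span_singleton_one, sup_top_eq]
    exact SeqReg.top _
  · intro r hr
    simpa using hr

end Effaceable

/-! ### Transfer of the criterion to a quotient ring. -/

section Quotient

variable {S : Type*} [CommRing S] [IsLocalRing S]

lemma map_mk_maximalIdeal (K : Ideal S) [IsLocalRing (S ⧸ K)] :
    (IsLocalRing.maximalIdeal S).map (Ideal.Quotient.mk K) =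
      IsLocalRing.maximalIdeal (S ⧸ K) := by
  refine IsLocalRing.eq_maximalIdeal ?_
  refine Ideal.IsMaximal.map_of_surjective_of_ker_le Ideal.Quotient.mk_surjective ?_
  rw [Ideal.mk_ker]
  refine IsLocalRing.le_maximalIdeal ?_
  rw [← Ideal.Quotient.nontrivial_iff]
  infer_instance

lemma ParameterData.map_mk {K : Ideal S} [IsLocalRing (S ⧸ K)] {c s : ℕ} {w : ℕ → S} {y₀ q : S}
    {ys : List S} (h1 : 1 ≤ c) (h2 : q ^ (s + 1) * y₀ ^ s ∈ Ideal.span {w 1} ⊔ K)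
    (h3 : w 0 ^ s * y₀ ^ s ∈ K) (h4 : q ^ (s + 1) ∈ Ideal.span {w 0} ⊔ Ideal.span {w 1} ⊔ K)
    (h5 : Ideal.ofList ((List.range c).map fun i => w (i + 1)) ⊔ Ideal.ofList ys ⊔
      Ideal.span {y₀} ⊔ Ideal.span {q} = IsLocalRing.maximalIdeal S)
    (h6 : w 0 ∈ IsLocalRing.maximalIdeal S) :
    ParameterData (S ⧸ K) c s (fun i => Ideal.Quotient.mk K (w i)) (Ideal.Quotient.mk K y₀)
      (Ideal.Quotient.mk K q) (ys.map (Ideal.Quotient.mk K)) where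
  one_le := h1
  pow_mul_pow_mem := by
    have h := Ideal.mem_map_of_mem (Ideal.Quotient.mk K) h2
    rwa [Ideal.map_sup, Ideal.map_quotient_self, sup_bot_eq, Ideal.map_span, Set.image_singleton,
      map_mul, map_pow, map_pow] at h
  pow_mul_pow_eq_zero := by
    rw [← map_pow, ← map_pow, ← map_mul]
    exact Ideal.Quotient.eq_zero_iff_mem.mpr h3
  pow_mem := by
    have h := Ideal.mem_map_of_mem (Ideal.Quotient.mk K) h4
    rwa [Ideal.map_sup, Ideal.map_quotient_self, sup_bot_eq, Ideal.map_sup, Ideal.map_span,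
      Ideal.map_span, Set.image_singleton, Set.image_singleton, map_pow] at h
  maximalIdeal_eq := by
    rw [← map_mk_maximalIdeal, ← h5, Ideal.map_sup, Ideal.map_sup, Ideal.map_sup,
      Ideal.map_ofList, Ideal.map_ofList, Ideal.map_span, Ideal.map_span, Set.image_singleton,
      Set.image_singleton, List.map_map]
    rfl
  zero_mem := by
    rw [← map_mk_maximalIdeal]
    exact Ideal.mem_map_of_mem _ h6

theorem ParameterData.not_isEffaceable_quotient {K : Ideal S} [IsLocalRing (S ⧸ K)]
    [IsNoetherianRing (S ⧸ K)] {c s t : ℕ} {w : ℕ → S} {y₀ q q' : S} {ys : List S}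
    (D : ParameterData (S ⧸ K) c s (fun i => Ideal.Quotient.mk K (w i)) (Ideal.Quotient.mk K y₀)
      (Ideal.Quotient.mk K q) (ys.map (Ideal.Quotient.mk K)))
    (hdim : ((c + (ys.length + 1) : ℕ) : WithBot ℕ∞) ≤ ringKrullDim (S ⧸ K)) {X M : Ideal S}
    (hXM : X ≤ M) (hM : M ≤ X ⊔ Ideal.span {q' ^ (t + 1)}) (hqM : q' ^ (t + 1) * y₀ ∈ M ⊔ K)
    (hK : K ≤ X ⊔ Ideal.span {q' ^ (t + 1)})
    (hw : ∀ i ≤ c, w i ∈ X ⊔ Ideal.span {q'})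
    (hP : X ⊔ Ideal.span {q'} ≤ IsLocalRing.maximalIdeal S)
    (hreg : SeqReg X (q' :: y₀ :: ys)) :
    ((∃ l : List S, SeqReg K l ∧ ys.length + 1 < l.length ∧
      ∀ a ∈ l, a ∈ IsLocalRing.maximalIdeal S) →
        ¬ IsEffaceable (S ⧸ K) (M.map (Ideal.Quotient.mk K)) (ys.length + 1 + 1)) ∧
    ¬ IsEffaceable (S ⧸ K) ((S ⧸ K) ⧸ M.map (Ideal.Quotient.mk K)) (ys.length + 1) := by
  have hlen : (ys.map (Ideal.Quotient.mk K)).length = ys.length := List.length_map _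
  have hsp : ∀ u, (X.map (Ideal.Quotient.mk K)) ⊔ Ideal.span {Ideal.Quotient.mk K q' ^ u} =
      (X ⊔ Ideal.span {q' ^ u}).map (Ideal.Quotient.mk K) := by
    intro u
    rw [Ideal.map_sup, Ideal.map_span, Set.image_singleton, map_pow]
  have hsp1 : (X.map (Ideal.Quotient.mk K)) ⊔ Ideal.span {Ideal.Quotient.mk K q'} =
      (X ⊔ Ideal.span {q'}).map (Ideal.Quotient.mk K) := by
    rw [Ideal.map_sup, Ideal.map_span, Set.image_singleton]
  -- All the quotients by `X + q' ^ u` with `u ≤ t + 1` already kill `K`, so regularity and the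
  -- colon condition can be checked upstairs in `S`.
  have hKu : ∀ u ≤ t + 1, K ≤ X ⊔ Ideal.span {q' ^ u} := fun u hu => hK.trans
    (sup_le_sup_left (Ideal.span_singleton_le_span_singleton.mpr (pow_dvd_pow q' hu)) _)
  have hregu : ∀ u ≤ t + 1, SeqReg ((X ⊔ Ideal.span {q' ^ u}).map (Ideal.Quotient.mk K))
      ((y₀ :: ys).map (Ideal.Quotient.mk K)) := by
    intro u hu
    refine SeqReg.map_mk K ?_
    rw [sup_eq_left.mpr (hKu u hu)]
    exact SeqReg.sup_pow hreg.1 hreg.2 u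
  have hmem : ∀ u ≤ t + 1, ∀ r, Ideal.Quotient.mk K r ∈
      (X ⊔ Ideal.span {q' ^ u}).map (Ideal.Quotient.mk K) → r ∈ X ⊔ Ideal.span {q' ^ u} := by
    intro u hu r hr
    rwa [← Ideal.mem_comap, Ideal.comap_map_of_surjective _ Ideal.Quotient.mk_surjective,
      ← RingHom.ker_eq_comap_bot, Ideal.mk_ker, sup_eq_left.mpr (hKu u hu)] at hr
  have key := D.not_isEffaceable (q' := Ideal.Quotient.mk K q') (t := t) (by rwa [hlen])
    (X := X.map (Ideal.Quotient.mk K)) (M := M.map (Ideal.Quotient.mk K)) (Ideal.map_mono hXM)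
    (by rw [hsp]; exact Ideal.map_mono hM)
    (by
      have h := Ideal.mem_map_of_mem (Ideal.Quotient.mk K) hqM
      rwa [Ideal.map_sup, Ideal.map_quotient_self, sup_bot_eq, map_mul, map_pow] at h)
    (fun i hi => by rw [hsp1]; exact Ideal.mem_map_of_mem _ (hw i hi))
    (by rw [hsp1, ← map_mk_maximalIdeal]; exact Ideal.map_mono hP)
    (by
      have h := hregu 1 (by omega)
      rw [pow_one] at h
      rwa [hsp1])
    (by rw [hsp]; exact hregu t (by omega))
    (fun r hr => by
      obtain ⟨r, rfl⟩ := Ideal.Quotient.mk_surjective r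
      rw [hsp, ← map_pow, ← map_mul] at hr
      rw [hsp1]
      refine Ideal.mem_map_of_mem _ ?_
      obtain ⟨a, ha⟩ := mem_sup_span_singleton_iff.mp (hmem _ le_rfl _ hr)
      refine mem_sup_span_singleton_iff.mpr ⟨a, hreg.1.pow t _ ?_⟩
      convert ha using 1
      ring)
  rw [hlen] at key
  refine ⟨?_, key.2⟩
  rintro ⟨l, hl, hll, hlm⟩
  refine key.1 ⟨l.map (Ideal.Quotient.mk K), ?_, by rwa [List.length_map], ?_⟩
  · have := SeqReg.map_mk K (J := ⊥) (l := l) (by rwa [bot_sup_eq])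
    rwa [Ideal.map_bot] at this
  · intro a ha
    obtain ⟨b, hb, rfl⟩ := List.mem_map.mp ha
    rw [← map_mk_maximalIdeal]
    exact Ideal.mem_map_of_mem _ (hlm b hb)

end Quotient

/-! ### Power series rings over a field or a discrete valuation ring. -/

section RegularCases

open MvPowerSeries

variable {A : Type*} [CommRing A]

lemma natVar_mem_ofList {e i : ℕ} {l : List ℕ} (hi : i ∈ l) :
    natVar A e i ∈ Ideal.ofList (l.map (natVar A e)) :=
  mem_ofList_of_mem (List.mem_map_of_mem hi)

lemma seqReg_bot_natVar {e : ℕ} {l : List ℕ} (hl : ∀ i ∈ l, i < e) (hn : l.Nodup) :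
    SeqReg (⊥ : Ideal (MvPowerSeries (Fin e) A)) (l.map (natVar A e)) := by
  simpa using seqReg_natVar' (A := A) (l₀ := []) hl (by simp) hn (by simp)

lemma seqReg_bot_C_cons_natVar [IsDomain A] {e : ℕ} {p : A} (hp : p ≠ 0) {l : List ℕ}
    (hl : ∀ i ∈ l, i < e) (hn : l.Nodup) :
    SeqReg (⊥ : Ideal (MvPowerSeries (Fin e) A)) (C p :: l.map (natVar A e)) := by
  simpa using seqReg_C_cons_natVar hp (l₀ := []) hl (by simp) hn (by simp)

variable [IsLocalRing A]

lemma natVar_mem_maximalIdeal (e i : ℕ) :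
    natVar A e i ∈ IsLocalRing.maximalIdeal (MvPowerSeries (Fin e) A) := by
  rw [IsLocalRing.mem_maximalIdeal, mem_nonunits_iff, isUnit_iff_constantCoeff, natVar]
  split_ifs <;> simp

lemma C_mem_maximalIdeal {p : A} (hp : IsLocalRing.maximalIdeal A = Ideal.span {p}) (e : ℕ) :
    C p ∈ IsLocalRing.maximalIdeal (MvPowerSeries (Fin e) A) := by
  rw [IsLocalRing.mem_maximalIdeal, mem_nonunits_iff, isUnit_iff_constantCoeff,
    constantCoeff_C, ← mem_nonunits_iff, ← IsLocalRing.mem_maximalIdeal, hp]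
  exact Ideal.mem_span_singleton_self p

lemma ofList_natVar_le_maximalIdeal (e : ℕ) (l : List ℕ) :
    Ideal.ofList (l.map (natVar A e)) ≤ IsLocalRing.maximalIdeal (MvPowerSeries (Fin e) A) := by
  rw [Ideal.ofList, Ideal.span_le]
  intro a ha
  obtain ⟨i, _, rfl⟩ := List.mem_map.mp ha
  exact natVar_mem_maximalIdeal e i

lemma mem_maximalIdeal_of_mem_C_cons_natVar {p : A} (hp : IsLocalRing.maximalIdeal A = Ideal.span {p})
    {e : ℕ} {l : List ℕ} {a : MvPowerSeries (Fin e) A} (ha : a ∈ C p :: l.map (natVar A e)) :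
    a ∈ IsLocalRing.maximalIdeal (MvPowerSeries (Fin e) A) := by
  rcases List.mem_cons.mp ha with rfl | ha
  · exact C_mem_maximalIdeal hp e
  · obtain ⟨i, _, rfl⟩ := List.mem_map.mp ha
    exact natVar_mem_maximalIdeal e i

/-- Variables over a field. -/
theorem not_isEffaceable_field {κ : Type*} [Field κ] {c h e : ℕ} (hc : 1 ≤ c)
    (he : e = c + (h + 1)) :
    let R := MvPowerSeries (Fin e) κ
    let M : Ideal R := Ideal.ofList ((List.range c).map (natVar κ e))
    ¬ IsEffaceable R M (h + 1 + 1) ∧ ¬ IsEffaceable R (R ⧸ M) (h + 1) := by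
  intro R M
  have hmax : IsLocalRing.maximalIdeal κ = Ideal.span {0} := by
    rw [IsLocalRing.maximalIdeal_eq_bot]; simp
  -- In a regular ring the chain starts at `0` and no extra generator is needed, so the relations in
  -- `ParameterData` hold trivially with `q = 0`.
  let w : ℕ → R := fun | 0 => 0 | i + 1 => natVar κ e i
  let ys := (List.range' (c + 1) h).map (natVar κ e)
  have hys : ys.length = h := by simp [ys]
  have D : ParameterData R c 1 w (natVar κ e c) 0 ys :=
    { one_le := hc
      pow_mul_pow_mem := by simp
      pow_mul_pow_eq_zero := by simp [w]
      pow_mem := by simp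
      maximalIdeal_eq := by
        rw [← maximalIdeal_natVar hmax (l := List.range c ++ c :: List.range' (c + 1) h),
          List.map_append, List.map_cons, Ideal.ofList_append, Ideal.ofList_cons, map_zero]
        · change Ideal.ofList ((List.range c).map (natVar κ e)) ⊔
            Ideal.ofList ((List.range' (c + 1) h).map (natVar κ e)) ⊔ _ ⊔ _ = _
          ac_rfl
        · intro i
          simp only [List.mem_append, List.mem_range, List.mem_cons, List.mem_range'_1]
          omega
      zero_mem := zero_mem _ }
  have hall : SeqReg (⊥ : Ideal R) ((List.range e).map (natVar κ e)) :=
    seqReg_bot_natVar (by simp) List.nodup_range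
  have hlen : ((List.range e).map (natVar κ e)).length = e := by simp
  have key := D.not_isEffaceable_of_seqReg (M := M) (by
      have h := hall.length_le_ringKrullDim_self (by
        rw [bot_sup_eq]
        exact ofList_natVar_le_maximalIdeal e _)
      rw [hlen] at h
      rw [hys]
      exact le_trans (by exact_mod_cast he.ge) h)
    (fun i hi => by
      cases i with
      | zero => exact zero_mem _
      | succ i => exact natVar_mem_ofList (List.mem_range.mpr hi))
    (ofList_natVar_le_maximalIdeal e _)
    (seqReg_natVar' (l := c :: List.range' (c + 1) h) (by
        simp only [List.mem_cons, List.mem_range'_1]; omega)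
      (by simp only [List.mem_range]; omega)
      (by simp [List.nodup_range', List.mem_range'_1])
      (by simp only [List.mem_cons, List.mem_range'_1, List.mem_range]; omega))
  rw [hys] at key
  refine ⟨key.1 ⟨_, hall, by omega, fun a ha => ?_⟩, key.2⟩
  obtain ⟨i, _, rfl⟩ := List.mem_map.mp ha
  exact natVar_mem_maximalIdeal e i

variable [IsDomain A] {p : A}

lemma length_le_ringKrullDim_natVar (hp : IsLocalRing.maximalIdeal A = Ideal.span {p})
    (hp0 : p ≠ 0) (e : ℕ) :
    ((e + 1 : ℕ) : WithBot ℕ∞) ≤ ringKrullDim (MvPowerSeries (Fin e) A) := by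
  have h := (seqReg_bot_C_cons_natVar (e := e) hp0 (l := List.range e) (by simp)
    List.nodup_range).length_le_ringKrullDim_self (by
      rw [bot_sup_eq, Ideal.ofList_cons]
      refine sup_le ?_ (ofList_natVar_le_maximalIdeal e _)
      rw [Ideal.span_singleton_le_iff_mem]
      exact C_mem_maximalIdeal hp e)
  simpa using h

/-- A power of the uniformizer and some variables, over a discrete valuation ring. -/
theorem not_isEffaceable_uniformizer_pow [IsNoetherianRing A]
    (hp : IsLocalRing.maximalIdeal A = Ideal.span {p}) (hp0 : p ≠ 0) {c h e t : ℕ}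
    (he : e = c + (h + 1)) :
    let R := MvPowerSeries (Fin e) A
    let M : Ideal R := Ideal.span {C p ^ (t + 1)} ⊔
      Ideal.ofList ((List.range c).map (natVar A e))
    ¬ IsEffaceable R M (h + 1 + 1) ∧ ¬ IsEffaceable R (R ⧸ M) (h + 1) := by
  intro R M
  -- The uniformizer heads the chain, which therefore has `c + 1` proper members; `c = 0` is
  -- allowed.
  let w : ℕ → R := fun | 0 => 0 | 1 => C p | i + 2 => natVar A e i
  let ys := (List.range' (c + 1) h).map (natVar A e)
  have hys : ys.length = h := by simp [ys]
  have D : ParameterData R (c + 1) 1 w (natVar A e c) 0 ys :=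
    { one_le := by omega
      pow_mul_pow_mem := by simp
      pow_mul_pow_eq_zero := by simp [w]
      pow_mem := by simp
      maximalIdeal_eq := by
        rw [← maximalIdeal_natVar hp (l := List.range c ++ c :: List.range' (c + 1) h),
          List.map_append, List.map_cons, Ideal.ofList_append, Ideal.ofList_cons,
          List.range_succ_eq_map, List.map_cons, List.map_map, Ideal.ofList_cons]
        · change Ideal.span {C p} ⊔ Ideal.ofList ((List.range c).map (natVar A e)) ⊔
            Ideal.ofList ((List.range' (c + 1) h).map (natVar A e)) ⊔ _ ⊔ _ = _
          rw [Ideal.span_singleton_eq_bot.mpr rfl, sup_bot_eq]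
          ac_rfl
        · intro i
          simp only [List.mem_append, List.mem_range, List.mem_cons, List.mem_range'_1]
          omega
      zero_mem := zero_mem _ }
  have hreg : SeqReg (Ideal.ofList ((List.range c).map (natVar A e)))
      (C p :: natVar A e c :: ys) :=
    seqReg_C_cons_natVar hp0 (l := c :: List.range' (c + 1) h) (by
        simp only [List.mem_cons, List.mem_range'_1]; omega)
      (by simp only [List.mem_range]; omega)
      (by simp [List.nodup_range', List.mem_range'_1])
      (by simp only [List.mem_cons, List.mem_range'_1, List.mem_range]; omega)
  have key := D.not_isEffaceable (M := M) (q' := C p) (t := t)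
    (X := Ideal.ofList ((List.range c).map (natVar A e))) (by
      rw [hys, show c + 1 + (h + 1) = e + 1 by omega]
      exact length_le_ringKrullDim_natVar hp hp0 e)
    le_sup_right (sup_comm _ _).le
    (Ideal.mem_sup_left (Ideal.mul_mem_right _ _ (Ideal.mem_span_singleton_self _)))
    (fun i hi => by
      match i, hi with
      | 0, _ => exact zero_mem _
      | 1, _ => exact Ideal.mem_sup_right (Ideal.mem_span_singleton_self _)
      | i + 2, hi =>
        exact Ideal.mem_sup_left (natVar_mem_ofList (List.mem_range.mpr (by omega))))
    (sup_le (ofList_natVar_le_maximalIdeal e _)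
      ((Ideal.span_singleton_le_iff_mem ..).mpr (C_mem_maximalIdeal hp e)))
    hreg.2 (SeqReg.sup_pow hreg.1 hreg.2 t)
    (fun r hr => by
      obtain ⟨a, ha⟩ := mem_sup_span_singleton_iff.mp hr
      refine mem_sup_span_singleton_iff.mpr ⟨a, hreg.1.pow t _ ?_⟩
      convert ha using 1
      ring)
  rw [hys] at key
  refine ⟨key.1 ⟨_, seqReg_bot_C_cons_natVar hp0 (l := List.range e) (by simp) List.nodup_range,
    by simp; omega, fun a ha => mem_maximalIdeal_of_mem_C_cons_natVar hp ha⟩, key.2⟩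

/-- Variables over a discrete valuation ring. -/
theorem not_isEffaceable_vars [IsNoetherianRing A]
    (hp : IsLocalRing.maximalIdeal A = Ideal.span {p}) (hp0 : p ≠ 0) {c h e : ℕ} (hc : 1 ≤ c)
    (he : e = c + h) :
    let R := MvPowerSeries (Fin e) A
    let M : Ideal R := Ideal.ofList ((List.range c).map (natVar A e))
    ¬ IsEffaceable R M (h + 1 + 1) ∧ ¬ IsEffaceable R (R ⧸ M) (h + 1) := by
  intro R M
  -- As `p` is regular modulo `M`, it takes the role of `y₀`.
  let w : ℕ → R := fun | 0 => 0 | i + 1 => natVar A e i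
  let ys := (List.range' c h).map (natVar A e)
  have hys : ys.length = h := by simp [ys]
  have D : ParameterData R c 1 w (C p) 0 ys :=
    { one_le := hc
      pow_mul_pow_mem := by simp
      pow_mul_pow_eq_zero := by simp [w]
      pow_mem := by simp
      maximalIdeal_eq := by
        rw [← maximalIdeal_natVar hp (l := List.range c ++ List.range' c h),
          List.map_append, Ideal.ofList_append]
        · change Ideal.ofList ((List.range c).map (natVar A e)) ⊔
            Ideal.ofList ((List.range' c h).map (natVar A e)) ⊔ _ ⊔ _ = _
          rw [Ideal.span_singleton_eq_bot.mpr rfl, sup_bot_eq]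
          ac_rfl
        · intro i
          simp only [List.mem_append, List.mem_range, List.mem_range'_1]
          omega
      zero_mem := zero_mem _ }
  have key := D.not_isEffaceable_of_seqReg (M := M) (by
      rw [hys, show c + (h + 1) = e + 1 by omega]
      exact length_le_ringKrullDim_natVar hp hp0 e)
    (fun i hi => by
      cases i with
      | zero => exact zero_mem _
      | succ i => exact natVar_mem_ofList (List.mem_range.mpr hi))
    (ofList_natVar_le_maximalIdeal e _)
    (seqReg_C_cons_natVar hp0 (l := List.range' c h) (by
        simp only [List.mem_range'_1]; omega)
      (by simp only [List.mem_range]; omega)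
      (by simp [List.nodup_range'])
      (by simp only [List.mem_range'_1, List.mem_range]; omega))
  rw [hys] at key
  refine ⟨key.1 ⟨_, seqReg_bot_C_cons_natVar hp0 (l := List.range e) (by simp) List.nodup_range,
    by simp; omega, fun a ha => mem_maximalIdeal_of_mem_C_cons_natVar hp ha⟩, key.2⟩

end RegularCases

/-! ### The rings `V[[x_1, …, x_e]] / (p^s x_1)`. -/

section HypersurfaceCases

open MvPowerSeries

/-- The ideal `(p^s x_1)` of `V[[x_1, …, x_e]]`. -/
noncomputable abbrev hypersurfaceIdeal (V : Type*) [CommRing V] (p : V) (s e : ℕ) (he : 0 < e) :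
    Ideal (MvPowerSeries (Fin e) V) :=
  Ideal.span {(algebraMap V (MvPowerSeries (Fin e) V) p) ^ s *
    (MvPowerSeries.X ⟨0, he⟩ : MvPowerSeries (Fin e) V)}

variable {V : Type*} [CommRing V] {p : V} {s e : ℕ} {he : 0 < e}

lemma hypersurfaceIdeal_eq :
    hypersurfaceIdeal V p s e he = Ideal.span {C p ^ s * natVar V e 0} := by
  rw [natVar, dif_pos he]
  rfl

lemma mul_mem_hypersurfaceIdeal : C p ^ s * natVar V e 0 ∈ hypersurfaceIdeal V p s e he := by
  rw [hypersurfaceIdeal_eq]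
  exact Ideal.mem_span_singleton_self _

lemma hypersurfaceIdeal_le {J : Ideal (MvPowerSeries (Fin e) V)}
    (h : C p ^ s * natVar V e 0 ∈ J) : hypersurfaceIdeal V p s e he ≤ J := by
  rwa [hypersurfaceIdeal_eq, Ideal.span_singleton_le_iff_mem]

lemma pow_mul_pow_mem_hypersurfaceIdeal {a b : ℕ} (ha : s ≤ a) (hb : 1 ≤ b) :
    C p ^ a * natVar V e 0 ^ b ∈ hypersurfaceIdeal V p s e he := by
  obtain ⟨a, rfl⟩ := Nat.exists_eq_add_of_le ha
  obtain ⟨b, rfl⟩ := Nat.exists_eq_add_of_le hb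
  convert Ideal.mul_mem_left _ (C p ^ a * natVar V e 0 ^ b) (mul_mem_hypersurfaceIdeal (he := he))
    using 1
  ring

/-- The variables other than `x_1` are a regular sequence modulo `p ^ s` and modulo `x_1`, hence
modulo the product. -/
lemma seqReg_hypersurfaceIdeal [IsDomain V] (hp0 : p ≠ 0) :
    SeqReg (hypersurfaceIdeal V p s e he) ((List.range' 1 (e - 1)).map (natVar V e)) := by
  have h1 : SeqReg (⊥ : Ideal (MvPowerSeries (Fin e) V))
      (C p :: (List.range' 1 (e - 1)).map (natVar V e)) :=
    seqReg_bot_C_cons_natVar hp0 (by simp only [List.mem_range'_1]; omega) List.nodup_range'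
  have h2 : SeqReg (⊥ : Ideal (MvPowerSeries (Fin e) V))
      (natVar V e 0 :: (List.range' 1 (e - 1)).map (natVar V e)) :=
    seqReg_bot_natVar (l := 0 :: List.range' 1 (e - 1))
      (by simp only [List.mem_cons, List.mem_range'_1]; omega)
      (by simp [List.nodup_range', List.mem_range'_1])
  have h := SeqReg.sup_mul (h1.1.pow s) (SeqReg.sup_pow h1.1 h1.2 s) h2.2
  rwa [bot_sup_eq, ← hypersurfaceIdeal_eq (he := he)] at h

variable [IsLocalRing V]

/-- The further quotient by `x_1` already has the regular sequence `p, x_2, …, x_e` of length `e`.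
-/
lemma length_le_ringKrullDim_hypersurface [IsDomain V]
    (hp : IsLocalRing.maximalIdeal V = Ideal.span {p}) (hp0 : p ≠ 0) :
    (e : WithBot ℕ∞) ≤ ringKrullDim (MvPowerSeries (Fin e) V ⧸ hypersurfaceIdeal V p s e he) := by
  have hloc : IsLocalRing (MvPowerSeries (Fin e) V ⧸ hypersurfaceIdeal V p s e he) :=
    HypersurfaceRing.isLocalRing V p s e he
  have h1 : SeqReg (Ideal.ofList ([0].map (natVar V e)))
      (C p :: (List.range' 1 (e - 1)).map (natVar V e)) :=
    seqReg_C_cons_natVar hp0 (by simp only [List.mem_range'_1]; omega)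
      (by simpa using he) List.nodup_range' (by simp [List.mem_range'_1]; omega)
  have h2 : hypersurfaceIdeal V p s e he ≤ Ideal.ofList ([0].map (natVar V e)) :=
    hypersurfaceIdeal_le (Ideal.mul_mem_left _ _ (natVar_mem_ofList (by simp)))
  have h3 := (SeqReg.map_mk (hypersurfaceIdeal V p s e he)
    (by rwa [sup_eq_left.mpr h2])).length_le_ringKrullDim_self (by
      rw [← map_mk_maximalIdeal, ← Ideal.map_ofList, ← Ideal.map_sup]
      refine Ideal.map_mono (sup_le (ofList_natVar_le_maximalIdeal e _) ?_)
      rw [Ideal.ofList_cons]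
      refine sup_le ?_ (ofList_natVar_le_maximalIdeal e _)
      rw [Ideal.span_singleton_le_iff_mem]
      exact C_mem_maximalIdeal hp e)
  have h4 : (List.map (Ideal.Quotient.mk (hypersurfaceIdeal V p s e he))
      (C p :: (List.range' 1 (e - 1)).map (natVar V e))).length = e := by
    simp; omega
  rwa [h4] at h3

/-- The sequence `x_2, …, x_e` has length `e - 1`, which suffices in the range `h ≤ d - 2` of the
claim about `M`. -/
lemma exists_seqReg_hypersurfaceIdeal [IsDomain V] (hp0 : p ≠ 0) {h : ℕ} (hh : h + 1 < e) :
    ∃ l, SeqReg (hypersurfaceIdeal V p s e he) l ∧ h < l.length ∧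
      ∀ a ∈ l, a ∈ IsLocalRing.maximalIdeal (MvPowerSeries (Fin e) V) := by
  refine ⟨_, seqReg_hypersurfaceIdeal hp0, by simp; omega, fun a ha => ?_⟩
  obtain ⟨i, _, rfl⟩ := List.mem_map.mp ha
  exact natVar_mem_maximalIdeal e i

variable [IsDomain V] [IsNoetherianRing V]

/-- The ideal `(p^k, x_1, …, x_c)` of `V[[x_1, …, x_e]] / (p^s x_1)`. -/
theorem not_isEffaceable_hypersurface_uniformizer_pow
    (hp : IsLocalRing.maximalIdeal V = Ideal.span {p}) (hp0 : p ≠ 0) (hs : 1 ≤ s) {c h k : ℕ}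
    (hc : 1 ≤ c) (hk : 1 ≤ k) (hce : e = c + (h + 1)) :
    let R := HypersurfaceRing V p s e he
    let M : Ideal R := (Ideal.span {C p ^ k} ⊔
      Ideal.ofList ((List.range c).map (natVar V e))).map (Ideal.Quotient.mk _)
    (h + 1 + 1 < e → ¬ IsEffaceable R M (h + 1 + 1)) ∧ ¬ IsEffaceable R (R ⧸ M) (h + 1) := by
  intro R M
  obtain ⟨t, rfl⟩ := Nat.exists_eq_add_of_le' hk
  -- Both `p` and `x_1` vanish modulo `P`, but together with the other variables they are one
  -- element too many for the chain. They share the parameter `p + x_1`, with `q = p`; then `p ^ (s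
  -- + 1) = p ^ s * (p + x_1)` in the quotient ring.
  let w : ℕ → MvPowerSeries (Fin e) V :=
    fun | 0 => 0 | 1 => C p + natVar V e 0 | i + 2 => natVar V e (i + 1)
  let ys := (List.range' (c + 1) h).map (natVar V e)
  have hys : ys.length = h := by simp [ys]
  have hrel : C p ^ (s + 1) ∈
      Ideal.span {C p + natVar V e 0} ⊔ hypersurfaceIdeal V p s e he := by
    have h1 := Ideal.mul_mem_left (Ideal.span {C p + natVar V e 0}) (C p ^ s)
      (Ideal.mem_span_singleton_self _)
    have h2 := Ideal.sub_mem _ (Ideal.mem_sup_left h1)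
      (Ideal.mem_sup_right (mul_mem_hypersurfaceIdeal (s := s) (p := p) (he := he)))
    convert h2 using 1
    ring
  have D := ParameterData.map_mk (K := hypersurfaceIdeal V p s e he) (c := c) (s := s) (w := w)
    (y₀ := natVar V e c) (q := C p) (ys := ys) hc (Ideal.mul_mem_right _ _ hrel)
    (by simp [w, show s ≠ 0 by omega]) (sup_le_sup_right (le_sup_right (a := Ideal.span {w 0}))
      (hypersurfaceIdeal V p s e he) hrel)
    (by
      obtain ⟨c, rfl⟩ := Nat.exists_eq_add_of_le' hc
      rw [← maximalIdeal_natVar hp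
          (l := 0 :: (List.range c).map Nat.succ ++ (c + 1) :: List.range' (c + 1 + 1) h),
        ← List.range_succ_eq_map,
        List.map_append, List.map_cons, Ideal.ofList_append, Ideal.ofList_cons,
        List.range_succ_eq_map, List.map_cons, List.map_map, Ideal.ofList_cons, List.map_cons,
        List.map_map, Ideal.ofList_cons]
      · change Ideal.span {C p + natVar V e 0} ⊔
          Ideal.ofList ((List.range c).map (natVar V e ∘ Nat.succ)) ⊔
          Ideal.ofList ((List.range' (c + 1 + 1) h).map (natVar V e)) ⊔
          Ideal.span {natVar V e (c + 1)} ⊔ Ideal.span {C p} = _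
        have h1 : Ideal.span {C p} ⊔ Ideal.span {C p + natVar V e 0} =
            Ideal.span {C p} ⊔ Ideal.span {natVar V e 0} := by
          apply le_antisymm <;> refine sup_le le_sup_left ?_ <;>
            rw [Ideal.span_singleton_le_iff_mem, mem_sup_span_singleton_iff]
          · exact ⟨1, by simp⟩
          · exact ⟨1, by simp⟩
        have h2 : ∀ P Q₁ Q₂ Y Z : Ideal (MvPowerSeries (Fin e) V),
            Q₁ ⊔ Q₂ ⊔ Y ⊔ Z ⊔ P = (P ⊔ Q₁) ⊔ (Q₂ ⊔ Z ⊔ Y) := by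
          intros; ac_rfl
        rw [h2, h1]
        ac_rfl
      · intro i
        rw [← List.range_succ_eq_map]
        simp only [List.mem_append, List.mem_range, List.mem_cons, List.mem_range'_1]
        omega)
    (zero_mem _)
  have hloc : IsLocalRing (MvPowerSeries (Fin e) V ⧸ hypersurfaceIdeal V p s e he) :=
    HypersurfaceRing.isLocalRing V p s e he
  have key := D.not_isEffaceable_quotient
    (M := Ideal.span {C p ^ (t + 1)} ⊔ Ideal.ofList ((List.range c).map (natVar V e)))
    (q' := C p) (t := t) (X := Ideal.ofList ((List.range c).map (natVar V e)))
    (by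
      rw [hys]
      exact le_trans (by exact_mod_cast hce.ge) (length_le_ringKrullDim_hypersurface hp hp0))
    le_sup_right (sup_comm _ _).le
    (Ideal.mem_sup_left (Ideal.mem_sup_left
      (Ideal.mul_mem_right _ _ (Ideal.mem_span_singleton_self _))))
    (hypersurfaceIdeal_le (Ideal.mem_sup_left
      (Ideal.mul_mem_left _ _ (natVar_mem_ofList (List.mem_range.mpr hc)))))
    (fun i hi => by
      match i, hi with
      | 0, _ => exact zero_mem _
      | 1, _ =>
        exact add_mem (Ideal.mem_sup_right (Ideal.mem_span_singleton_self _))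
          (Ideal.mem_sup_left (natVar_mem_ofList (List.mem_range.mpr hc)))
      | i + 2, hi =>
        exact Ideal.mem_sup_left (natVar_mem_ofList (List.mem_range.mpr (by omega))))
    (sup_le (ofList_natVar_le_maximalIdeal e _)
      ((Ideal.span_singleton_le_iff_mem ..).mpr (C_mem_maximalIdeal hp e)))
    (seqReg_C_cons_natVar hp0 (l := c :: List.range' (c + 1) h) (by
        simp only [List.mem_cons, List.mem_range'_1]; omega)
      (by simp only [List.mem_range]; omega)
      (by simp [List.nodup_range', List.mem_range'_1])
      (by simp only [List.mem_cons, List.mem_range'_1, List.mem_range]; omega))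
  rw [hys] at key
  exact ⟨fun hh => key.1 (exists_seqReg_hypersurfaceIdeal hp0 hh), key.2⟩

/-- The ideal `(p^k, x_2, …, x_{c+1})` of `V[[x_1, …, x_e]] / (p^s x_1)`. -/
theorem not_isEffaceable_hypersurface_uniformizer_pow'
    (hp : IsLocalRing.maximalIdeal V = Ideal.span {p}) (hp0 : p ≠ 0) (hs : 1 ≤ s) {c h k : ℕ}
    (hc : 1 ≤ c) (hk : 1 ≤ k) (hce : e = c + (h + 1)) :
    let R := HypersurfaceRing V p s e he
    let M : Ideal R := (Ideal.span {C p ^ k} ⊔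
      Ideal.ofList ((List.range' 1 c).map (natVar V e))).map (Ideal.Quotient.mk _)
    (h + 1 + 1 < e → ¬ IsEffaceable R M (h + 1 + 1)) ∧ ¬ IsEffaceable R (R ⧸ M) (h + 1) := by
  intro R M
  -- The exponent must be at most `s` for `p ^ s x_1` to vanish in the outer quotient, and at most
  -- `k` for `M` to lie in `X + p ^ (t + 1)`. If it is `s`, then `p ^ s * y₀ = 0` since `y₀ = x_1`:
  -- here the sandwich with its factor `y₀` is essential.
  obtain ⟨t, ht⟩ : ∃ t, min k s = t + 1 := ⟨min k s - 1, by omega⟩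
  let w : ℕ → MvPowerSeries (Fin e) V := fun | 0 => C p | i + 1 => natVar V e (i + 1)
  let ys := (List.range' (c + 1) h).map (natVar V e)
  have hys : ys.length = h := by simp [ys]
  have D := ParameterData.map_mk (K := hypersurfaceIdeal V p s e he) (c := c) (s := s) (w := w)
    (y₀ := natVar V e 0) (q := C p) (ys := ys) hc
    (Ideal.mem_sup_right (pow_mul_pow_mem_hypersurfaceIdeal (Nat.le_succ s) hs))
    (pow_mul_pow_mem_hypersurfaceIdeal le_rfl hs)
    (Ideal.mem_sup_left (Ideal.mem_sup_left
      (Ideal.pow_mem_of_mem _ (Ideal.mem_span_singleton_self _) _ (Nat.succ_pos s))))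
    (by
      rw [← maximalIdeal_natVar hp
          (l := 0 :: ((List.range c).map Nat.succ ++ List.range' (c + 1) h)),
        List.map_cons, List.map_append, Ideal.ofList_cons, Ideal.ofList_append, List.map_map]
      · change Ideal.ofList ((List.range c).map (natVar V e ∘ Nat.succ)) ⊔
          Ideal.ofList ((List.range' (c + 1) h).map (natVar V e)) ⊔ _ ⊔ _ = _
        ac_rfl
      · intro i
        rw [← List.cons_append, ← List.range_succ_eq_map]
        simp only [List.mem_append, List.mem_range, List.mem_range'_1]
        omega)
    (C_mem_maximalIdeal hp e)
  have hloc : IsLocalRing (MvPowerSeries (Fin e) V ⧸ hypersurfaceIdeal V p s e he) :=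
    HypersurfaceRing.isLocalRing V p s e he
  have hpow : ∀ j, t + 1 ≤ j → C p ^ j ∈
      Ideal.span {(C p : MvPowerSeries (Fin e) V) ^ (t + 1)} := fun j hj =>
    Ideal.mem_span_singleton.mpr (pow_dvd_pow _ hj)
  have key := D.not_isEffaceable_quotient
    (M := Ideal.span {C p ^ k} ⊔ Ideal.ofList ((List.range' 1 c).map (natVar V e)))
    (q' := C p) (t := t) (X := Ideal.ofList ((List.range' 1 c).map (natVar V e)))
    (by
      rw [hys]
      exact le_trans (by exact_mod_cast hce.ge) (length_le_ringKrullDim_hypersurface hp hp0))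
    le_sup_right
    (sup_le (((Ideal.span_singleton_le_iff_mem ..).mpr (hpow k (by omega))).trans le_sup_right)
      le_sup_left)
    (by
      rcases min_choice k s with h1 | h1
      · rw [← ht, h1]
        exact Ideal.mem_sup_left (Ideal.mem_sup_left
          (Ideal.mul_mem_right _ _ (Ideal.mem_span_singleton_self _)))
      · rw [← ht, h1]
        exact Ideal.mem_sup_right mul_mem_hypersurfaceIdeal)
    (hypersurfaceIdeal_le (Ideal.mem_sup_right (Ideal.mul_mem_right _ _ (hpow s (by omega)))))
    (fun i hi => by
      match i, hi with
      | 0, _ => exact Ideal.mem_sup_right (Ideal.mem_span_singleton_self _)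
      | i + 1, hi =>
        exact Ideal.mem_sup_left (natVar_mem_ofList (List.mem_range'_1.mpr (by omega))))
    (sup_le (ofList_natVar_le_maximalIdeal e _)
      ((Ideal.span_singleton_le_iff_mem ..).mpr (C_mem_maximalIdeal hp e)))
    (seqReg_C_cons_natVar hp0 (l := 0 :: List.range' (c + 1) h) (by
        simp only [List.mem_cons, List.mem_range'_1]; omega)
      (by simp only [List.mem_range'_1]; omega)
      (by simp [List.nodup_range', List.mem_range'_1])
      (by simp only [List.mem_cons, List.mem_range'_1]; omega))
  rw [hys] at key
  exact ⟨fun hh => key.1 (exists_seqReg_hypersurfaceIdeal hp0 hh), key.2⟩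

/-- The ideal `(x_1, …, x_{c+1})` of `V[[x_1, …, x_e]] / (p^s x_1)`. -/
theorem not_isEffaceable_hypersurface_vars
    (hp : IsLocalRing.maximalIdeal V = Ideal.span {p}) (hp0 : p ≠ 0) (hs : 1 ≤ s) {c h : ℕ}
    (hc : 1 ≤ c) (hce : e = c + (h + 1)) :
    let R := HypersurfaceRing V p s e he
    let M : Ideal R := (Ideal.ofList ((List.range (c + 1)).map (natVar V e))).map
      (Ideal.Quotient.mk _)
    (h + 1 + 1 < e → ¬ IsEffaceable R M (h + 1 + 1)) ∧ ¬ IsEffaceable R (R ⧸ M) (h + 1) := by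
  intro R M
  -- Here `w 0 = q = x_1` and `y₀ = p`, so the relation `p ^ s x_1 = 0` starts the chain with the
  -- roles of `p` and `x_1` exchanged.
  let w : ℕ → MvPowerSeries (Fin e) V := natVar V e
  let ys := (List.range' (c + 1) h).map (natVar V e)
  have hys : ys.length = h := by simp [ys]
  have D := ParameterData.map_mk (K := hypersurfaceIdeal V p s e he) (c := c) (s := s) (w := w)
    (y₀ := C p) (q := natVar V e 0) (ys := ys) hc
    (Ideal.mem_sup_right (by
      rw [mul_comm]
      exact pow_mul_pow_mem_hypersurfaceIdeal le_rfl (Nat.le_add_left 1 s)))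
    (by
      rw [mul_comm]
      exact pow_mul_pow_mem_hypersurfaceIdeal le_rfl hs)
    (Ideal.mem_sup_left (Ideal.mem_sup_left
      (Ideal.pow_mem_of_mem _ (Ideal.mem_span_singleton_self _) _ (Nat.succ_pos s))))
    (by
      rw [← maximalIdeal_natVar hp
          (l := 0 :: ((List.range c).map Nat.succ ++ List.range' (c + 1) h)),
        List.map_cons, List.map_append, Ideal.ofList_cons, Ideal.ofList_append, List.map_map]
      · change Ideal.ofList ((List.range c).map (natVar V e ∘ Nat.succ)) ⊔
          Ideal.ofList ((List.range' (c + 1) h).map (natVar V e)) ⊔ _ ⊔ _ = _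
        ac_rfl
      · intro i
        rw [← List.cons_append, ← List.range_succ_eq_map]
        simp only [List.mem_append, List.mem_range, List.mem_range'_1]
        omega)
    (natVar_mem_maximalIdeal e 0)
  have hloc : IsLocalRing (MvPowerSeries (Fin e) V ⧸ hypersurfaceIdeal V p s e he) :=
    HypersurfaceRing.isLocalRing V p s e he
  have hM : Ideal.ofList ((List.range (c + 1)).map (natVar V e)) =
      Ideal.ofList ((List.range c).map (natVar V e)) ⊔ Ideal.span {natVar V e c} := by
    rw [List.range_succ, List.map_append, Ideal.ofList_append, List.map_singleton,
      Ideal.ofList_singleton]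
  have key := D.not_isEffaceable_quotient
    (M := Ideal.ofList ((List.range (c + 1)).map (natVar V e)))
    -- Splitting off the last variable as `q'` with `t = 0` gives `X + q' = M`, so the sandwich is
    -- trivial.
    (q' := natVar V e c) (t := 0) (X := Ideal.ofList ((List.range c).map (natVar V e)))
    (by
      rw [hys]
      exact le_trans (by exact_mod_cast hce.ge) (length_le_ringKrullDim_hypersurface hp hp0))
    (hM ▸ le_sup_left) (by rw [hM, zero_add, pow_one])
    (by
      rw [zero_add, pow_one]
      exact Ideal.mem_sup_left (Ideal.mul_mem_right _ _
        (natVar_mem_ofList (List.mem_range.mpr (Nat.lt_succ_self c)))))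
    (hypersurfaceIdeal_le (Ideal.mem_sup_left
      (Ideal.mul_mem_left _ _ (natVar_mem_ofList (List.mem_range.mpr hc)))))
    (fun i hi => by
      rw [← hM]
      exact natVar_mem_ofList (List.mem_range.mpr (by omega)))
    (by rw [← hM]; exact ofList_natVar_le_maximalIdeal e _)
    (by
      refine SeqReg.append (l₁ := [natVar V e c]) ?_ ?_
      · exact seqReg_natVar' (l := [c]) (by simp; omega) (by simp only [List.mem_range]; omega)
          (by simp) (by simp)
      · rw [Ideal.ofList_singleton, ← hM]
        exact seqReg_C_cons_natVar hp0 (l := List.range' (c + 1) h) (by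
            simp only [List.mem_range'_1]; omega)
          (by simp only [List.mem_range]; omega) List.nodup_range'
          (by simp only [List.mem_range'_1, List.mem_range]; omega))
  rw [hys] at key
  exact ⟨fun hh => key.1 (exists_seqReg_hypersurfaceIdeal hp0 hh), key.2⟩

end HypersurfaceCases

/-! ### Identification of the ideals and assembly of the six cases. -/

lemma map_mk_idealOfVars_X {V : Type*} [CommRing V] (p : V) (s e : ℕ) (he : 0 < e) (a b : ℕ) :
    (idealOfVars (MvPowerSeries.X : Fin e → MvPowerSeries (Fin e) V) a b).map
      (Ideal.Quotient.mk (hypersurfaceIdeal V p s e he)) =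
    idealOfVars (hypersurfaceVar V p s e he) a b := by
  unfold idealOfVars
  rw [Ideal.map_span]
  congr 1
  ext r
  constructor
  · rintro ⟨_, ⟨j, h1, h2, rfl⟩, rfl⟩
    exact ⟨j, h1, h2, rfl⟩
  · rintro ⟨j, h1, h2, rfl⟩
    exact ⟨_, ⟨j, h1, h2, rfl⟩, rfl⟩

lemma map_mk_span_sup_idealOfVars_X {V : Type*} [CommRing V] (p : V) (k s e : ℕ) (he : 0 < e)
    (a b : ℕ) :
    (Ideal.span {MvPowerSeries.C p ^ k} ⊔
      idealOfVars (MvPowerSeries.X : Fin e → MvPowerSeries (Fin e) V) a b).map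
      (Ideal.Quotient.mk (hypersurfaceIdeal V p s e he)) =
    Ideal.span {algebraMap V (HypersurfaceRing V p s e he) p ^ k} ⊔
      idealOfVars (hypersurfaceVar V p s e he) a b := by
  rw [Ideal.map_sup, map_mk_idealOfVars_X, Ideal.map_span, Set.image_singleton, map_pow]
  rfl

theorem mainTheorem9
    {κ : Type*} [Field κ]
    {V : Type*} [CommRing V] [IsDomain V] [IsDiscreteValuationRing V]
    (p : V) (hp : IsLocalRing.maximalIdeal V = Ideal.span {p})
    (d k s h : ℕ) (hd : 3 ≤ d) (hk : 1 ≤ k) (hs : 1 ≤ s) (hh : 1 ≤ h) (hhd : h ≤ d - 1) :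
    -- `R = κ[[x_1, …, x_d]]`, `M = (x_1, …, x_{d-h})`
    (let R := MvPowerSeries (Fin d) κ
     let M : Ideal R := idealOfVars MvPowerSeries.X 1 (d - h)
     (h ≤ d - 2 → ¬ IsEffaceable R M (h + 1)) ∧ ¬ IsEffaceable R (R ⧸ M) h) ∧
    -- `R = V[[x_1, …, x_{d-1}]]`, `M = (p^k, x_1, …, x_{d-(h+1)})`
    (let R := MvPowerSeries (Fin (d - 1)) V
     let M : Ideal R :=
      Ideal.span {algebraMap V R p ^ k} ⊔ idealOfVars MvPowerSeries.X 1 (d - (h + 1))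
     (h ≤ d - 2 → ¬ IsEffaceable R M (h + 1)) ∧ ¬ IsEffaceable R (R ⧸ M) h) ∧
    -- `R = V[[x_1, …, x_{d-1}]]`, `M = (x_1, …, x_{d-h})`
    (let R := MvPowerSeries (Fin (d - 1)) V
     let M : Ideal R := idealOfVars MvPowerSeries.X 1 (d - h)
     (h ≤ d - 2 → ¬ IsEffaceable R M (h + 1)) ∧ ¬ IsEffaceable R (R ⧸ M) h) ∧
    -- `R = V[[x_1, …, x_d]]/(p^s x_1)`, `M = (p^k, x_1, …, x_{d-h})`
    (let R := HypersurfaceRing V p s d (by omega)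
     let M : Ideal R :=
      Ideal.span {algebraMap V R p ^ k} ⊔
        idealOfVars (hypersurfaceVar V p s d (by omega)) 1 (d - h)
     (h ≤ d - 2 → ¬ IsEffaceable R M (h + 1)) ∧ ¬ IsEffaceable R (R ⧸ M) h) ∧
    -- `R = V[[x_1, …, x_d]]/(p^s x_1)`, `M = (p^k, x_2, …, x_{d-(h-1)})`
    (let R := HypersurfaceRing V p s d (by omega)
     let M : Ideal R :=
      Ideal.span {algebraMap V R p ^ k} ⊔
        idealOfVars (hypersurfaceVar V p s d (by omega)) 2 (d - (h - 1))
     (h ≤ d - 2 → ¬ IsEffaceable R M (h + 1)) ∧ ¬ IsEffaceable R (R ⧸ M) h) ∧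
    -- `R = V[[x_1, …, x_d]]/(p^s x_1)`, `M = (x_1, …, x_{d-(h-1)})`
    (let R := HypersurfaceRing V p s d (by omega)
     let M : Ideal R := idealOfVars (hypersurfaceVar V p s d (by omega)) 1 (d - (h - 1))
     (h ≤ d - 2 → ¬ IsEffaceable R M (h + 1)) ∧ ¬ IsEffaceable R (R ⧸ M) h) := by
  have hp0 : p ≠ 0 := by
    rintro rfl
    refine IsDiscreteValuationRing.not_a_field V ?_
    rw [hp, Ideal.span_singleton_eq_bot.mpr rfl]
  -- From here `h` is the number of elements of `ys`, one less than the degree in the theorem.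
  obtain ⟨h, rfl⟩ := Nat.exists_eq_add_of_le' hh
  have hc : 1 ≤ d - (h + 1) := by omega
  refine ⟨?_, ?_, ?_, ?_, ?_, ?_⟩
  · have hM := idealOfVars_X_eq (A := κ) (e := d) (a := 1) (b := d - (h + 1))
      (l := List.range (d - (h + 1))) (by simp only [List.mem_range]; omega)
    have key := not_isEffaceable_field (κ := κ) (h := h) (e := d) hc (by omega)
    dsimp only at key
    rw [← hM] at key
    exact ⟨fun _ => key.1, key.2⟩
  · have hM := idealOfVars_X_eq (A := V) (e := d - 1) (a := 1) (b := d - (h + 1 + 1))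
      (l := List.range (d - (h + 1 + 1))) (by simp only [List.mem_range]; omega)
    obtain ⟨t, rfl⟩ := Nat.exists_eq_add_of_le' hk
    have key := not_isEffaceable_uniformizer_pow (c := d - (h + 1 + 1)) (h := h) (e := d - 1)
      (t := t) hp hp0 (by omega)
    dsimp only at key
    rw [← hM] at key
    exact ⟨fun _ => key.1, key.2⟩
  · have hM := idealOfVars_X_eq (A := V) (e := d - 1) (a := 1) (b := d - (h + 1))
      (l := List.range (d - (h + 1))) (by simp only [List.mem_range]; omega)
    have key := not_isEffaceable_vars (h := h) (e := d - 1) hp hp0 hc (by omega)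
    dsimp only at key
    rw [← hM] at key
    exact ⟨fun _ => key.1, key.2⟩
  · have hM := idealOfVars_X_eq (A := V) (e := d) (a := 1) (b := d - (h + 1))
      (l := List.range (d - (h + 1))) (by simp only [List.mem_range]; omega)
    have key := not_isEffaceable_hypersurface_uniformizer_pow (e := d) (he := by omega) (h := h)
      hp hp0 hs hc hk (by omega)
    dsimp only at key
    rw [← hM, map_mk_span_sup_idealOfVars_X] at key
    exact ⟨fun hh => key.1 (by omega), key.2⟩
  · have hM := idealOfVars_X_eq (A := V) (e := d) (a := 2) (b := d - (h + 1 - 1))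
      (l := List.range' 1 (d - (h + 1))) (by simp only [List.mem_range'_1]; omega)
    have key := not_isEffaceable_hypersurface_uniformizer_pow' (e := d) (he := by omega) (h := h)
      hp hp0 hs hc hk (by omega)
    dsimp only at key
    rw [← hM, map_mk_span_sup_idealOfVars_X] at key
    exact ⟨fun hh => key.1 (by omega), key.2⟩
  · have hM := idealOfVars_X_eq (A := V) (e := d) (a := 1) (b := d - (h + 1 - 1))
      (l := List.range (d - (h + 1) + 1)) (by simp only [List.mem_range]; omega)
    have key := not_isEffaceable_hypersurface_vars (e := d) (he := by omega) (h := h)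
      hp hp0 hs hc (by omega)
    dsimp only at key
    rw [← hM, map_mk_idealOfVars_X] at key
    exact ⟨fun hh => key.1 (by omega), key.2⟩
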